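/- Let $E,F$ be finite-dimensional real inner product spaces, $\mathcal A:E\to F$ linear with adjoint $\mathcal A^{T}$, $b\in F$, $c\in E$, and let $\mathcal K^1,\mathcal K^2\subseteq E$ be nonempty closed convex cones, $\mathcal K=\mathcal K^1\cap\mathcal K^2$. Consider $$(P)\ \inf\{\langle c,x\rangle : \mathcal A x=b,\ x\in\mathcal K^*\},\qquad (D)\ \sup\{\langle b,y\rangle : c-\mathcal A^{T}y\in\mathcal K\},$$ and the duplicated pair $$(P_{\rm dup})\ \inf\{\langle c,x^1+x^2\rangle : \mathcal A(x^1+x^2)=b,\ (x^1,x^2)\in(\mathcal K^1)^*\times(\mathcal K^2)^*\},$$ $$(D_{\rm dup})\ \sup\{\langle b,y\rangle : (c-\mathcal A^{T}y,\,c-\mathcal A^{T}y)\in\mathcal K^1\times\mathcal K^2\}.$$ The values of infeasible problems are $+\infty$ for an infimum and $-\infty$ for a supremum. The minimal face of a dual problem is the smallest (possibly empty) face of its cone that contains all its feasible slacks $c-\mathcal A^{T}y$; it is empty if and only if the problem is infeasible. Definitions (for a dual problem with cone $\mathcal K$; for $(D_{\rm dup})$ they are applied to the cone $\mathcal K^1\times\mathcal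 K^2$, the map $(x^1,x^2)\mapsto\mathcal A(x^1+x^2)$ and the vector $(c,c)$). *Facial reduction*: start with $\mathcal F_1=\mathcal K$. A step at the nonempty face $\mathcal F_i$ chooses $d_i\in\mathcal F_i^*\cap\ker\mathcal A$ such that either (i) $\langle c,d_i\rangle=0$ and $d_i\notin\mathcal F_i^\perp$, and then $\mathcal F_{i+1}=\mathcal F_i\cap\{d_i\}^\perp$; or (ii) $\langle c,d_i\rangle<0$, and then $\mathcal F_{i+1}=\emptyset$ and the procedure stops (the problem is infeasible). It also stops when no such $d_i$ exists. The *singularity degree* $d(D)$ is the least number of directions in a complete run. The *distance to strong duality* $\mathrm{dist}_S(D)$ is the least number $\ell$ of facial reduction steps (in a possibly incomplete run) after which $\hat\theta=\inf\{\langle c,x\rangle:\mathcal A x=b,\ x\in\mathcal F_{\ell+1}^*\}$ equals the optimal value $\theta_D$ of $(D)$, the infimum being moreover attained if $\theta_D$ is finite ($\mathrm{dist}_S(D)=\infty$ if there is no such $\ell$; $\emptyset^*$ is the whole space). The *distance to polyhedrality* $\mathrm{dist}_P(\mathcal K)$ of a nonempty closed convex cone is the greatest length minus one of a strictly ascending chain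 $\mathcal F_1\subsetneq\dots\subsetneq\mathcal F_\ell$ of nonempty faces of $\mathcal K$ such that $\mathcal F_1$ is polyhedral and $\mathcal F_j$ is not polyhedral for $j>1$; this is a finite number. **Theorem.** (i) The minimal face of $(D_{\rm dup})$ has the form $\mathcal F^1\times\mathcal F^2$ with faces $\mathcal F^1$ of $\mathcal K^1$ and $\mathcal F^2$ of $\mathcal K^2$, and whenever it is written as $\mathcal F^1\times\mathcal F^2$, the minimal face of $(D)$ is $\mathcal F^1\cap\mathcal F^2$. (ii) $\mathrm{dist}_P(\mathcal K^1)$ and $\mathrm{dist}_P(\mathcal K^2)$ are finite, and $$d(D)\le d(D_{\rm dup})\le 1+\mathrm{dist}_P(\mathcal K^1)+\mathrm{dist}_P(\mathcal K^2),\qquad \mathrm{dist}_S(D)\le\mathrm{dist}_S(D_{\rm dup}).$$ If at least one of $(P)$ and $(D)$ is feasible, then moreover $$\mathrm{dist}_S(D_{\rm dup})\le\mathrm{dist}_P(\mathcal K^1)+\mathrm{dist}_P(\mathcal K^2).$$ -/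

import Mathlib

open scoped InnerProductSpace

noncomputable section

namespace ConicLP

/-- `F` is a (possibly empty) face of the convex set `K`: a convex subset of `K` which contains
both end points of every segment of `K` whose relative interior it meets. -/
def IsFace {E : Type*} [AddCommGroup E] [Module ℝ E] (K F : Set E) : Prop :=
  IsExtreme ℝ K F ∧ Convex ℝ F

/-- The minimal face of `K` that contains the subset `S` of `K`
(the empty face if `S` is empty). -/
def minFace {E : Type*} [AddCommGroup E] [Module ℝ E] (K S : Set E) : Set E :=
  ⋂₀ {F | IsFace K F ∧ S ⊆ F}

/-- The dual cone `{s | ⟪x, s⟫ ≥ 0 for all x ∈ F}`; the dual of the empty set is everything. -/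
def dualCone {E : Type*} [NormedAddCommGroup E] [InnerProductSpace ℝ E] (F : Set E) :
    PointedCone ℝ E :=
  PointedCone.dual (innerₗ E) F

/-- A polyhedral cone: the solution set of finitely many homogeneous linear inequalities. -/
def IsPolyhedralCone {E : Type*} [NormedAddCommGroup E] [InnerProductSpace ℝ E] (S : Set E) :
    Prop :=
  ∃ t : Finset E, S = {x | ∀ a ∈ t, 0 ≤ ⟪a, x⟫_ℝ}

/-- `F 0 ⊂ F 1 ⊂ ⋯ ⊂ F k` is a strictly ascending chain of `k + 1` nonempty faces of `K`, the
first of which is polyhedral while all the others are not. -/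
structure IsPolyhedralityChain {E : Type*} [NormedAddCommGroup E] [InnerProductSpace ℝ E]
    (K : Set E) (k : ℕ) (F : Fin (k + 1) → Set E) : Prop where
  strictMono : StrictMono F
  isFace : ∀ i, IsFace K (F i)
  nonempty : ∀ i, (F i).Nonempty
  polyhedral_zero : IsPolyhedralCone (F 0)
  not_polyhedral : ∀ i, i ≠ 0 → ¬ IsPolyhedralCone (F i)

/-- The distance to polyhedrality: the maximal length, minus one, of a chain as in
`IsPolyhedralityChain`. -/
def distPoly {E : Type*} [NormedAddCommGroup E] [InnerProductSpace ℝ E] (K : Set E) : ℕ∞ :=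
  sSup {n : ℕ∞ | ∃ k : ℕ, n = (k : ℕ∞) ∧ ∃ F : Fin (k + 1) → Set E, IsPolyhedralityChain K k F}

/-- The data of the pair of conic linear programs
`inf {⟪c, x⟫ | A x = b, x ∈ K*}` (primal) and `sup {⟪b, y⟫ | c - Aᵀ y ∈ K}` (dual),
where `K` is a nonempty closed convex cone. -/
structure Program (E F : Type*) [NormedAddCommGroup E] [InnerProductSpace ℝ E]
    [NormedAddCommGroup F] [InnerProductSpace ℝ F] where
  K : ProperCone ℝ E
  A : E →ₗ[ℝ] F
  b : F
  c : E

namespace Program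

variable {E F : Type*} [NormedAddCommGroup E] [InnerProductSpace ℝ E] [FiniteDimensional ℝ E]
  [NormedAddCommGroup F] [InnerProductSpace ℝ F] [FiniteDimensional ℝ F]

/-- The feasible region of the dual problem. -/
def dualFeasible (P : Program E F) : Set F :=
  {y | P.c - LinearMap.adjoint P.A y ∈ P.K}

/-- The set of feasible slacks `c - Aᵀ y ∈ K` of the dual problem. -/
def feasibleSlacks (P : Program E F) : Set E :=
  {s | s ∈ P.K ∧ ∃ y : F, s = P.c - LinearMap.adjoint P.A y}

/-- The minimal face of the cone that contains the feasible slacks. -/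
def dualMinFace (P : Program E F) : Set E :=
  minFace (P.K : Set E) P.feasibleSlacks

/-- The dual optimal value (`⊥` if infeasible, `⊤` if unbounded). -/
def dualValue (P : Program E F) : EReal :=
  ⨆ y ∈ P.dualFeasible, ((⟪P.b, y⟫_ℝ : ℝ) : EReal)

/-- The feasible region of the primal problem with the set `G` in place of the cone `K`,
namely `{x | A x = b, x ∈ G*}`. -/
def primalFeasible (P : Program E F) (G : Set E) : Set E :=
  {x | P.A x = P.b ∧ x ∈ dualCone G}

/-- The optimal value of the primal problem with the set `G` in place of the cone `K`
(`⊤` if infeasible, `⊥` if unbounded). -/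
def primalValue (P : Program E F) (G : Set E) : EReal :=
  ⨅ x ∈ P.primalFeasible G, ((⟪P.c, x⟫_ℝ : ℝ) : EReal)

/-- `P.FacialReduction ds G`: the generic facial reduction algorithm for the dual problem can find
the directions `ds` (in this order), after which its current face is `G`.
Starting from `K`, a step at the current face `G` picks `d ∈ G* ∩ ker A` such that
* either `⟪c, d⟫ = 0` and `d ∉ G^⊥`, and the new face is `G ∩ {d}^⊥`;
* or `⟪c, d⟫ < 0`, and the new face is empty: the problem is infeasible.
No step is possible from the empty face. -/
inductive FacialReduction (P : Program E F) : List E → Set E → Prop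
  | start : FacialReduction P [] (P.K : Set E)
  | reduce (ds : List E) (G : Set E) (d : E) (hG : FacialReduction P ds G)
      (hd : d ∈ dualCone G) (hA : P.A d = 0) (hc : ⟪P.c, d⟫_ℝ = 0)
      (hperp : ∃ x ∈ G, ⟪x, d⟫_ℝ ≠ 0) :
      FacialReduction P (ds ++ [d]) (G ∩ {x | ⟪x, d⟫_ℝ = 0})
  | infeasible (ds : List E) (G : Set E) (d : E) (hG : FacialReduction P ds G)
      (hne : G.Nonempty) (hd : d ∈ dualCone G) (hA : P.A d = 0) (hc : ⟪P.c, d⟫_ℝ < 0) :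
      FacialReduction P (ds ++ [d]) ∅

/-- `ds` is a possible output of the generic facial reduction algorithm: it ends either because
infeasibility was detected, or because no further direction exists. -/
def IsOutput (P : Program E F) (ds : List E) : Prop :=
  ∃ G : Set E, P.FacialReduction ds G ∧
    (G = ∅ ∨ ¬ ∃ d ∈ dualCone G, P.A d = 0 ∧
      ((⟪P.c, d⟫_ℝ = 0 ∧ ∃ x ∈ G, ⟪x, d⟫_ℝ ≠ 0) ∨ ⟪P.c, d⟫_ℝ < 0))

/-- The singularity degree of the dual problem: the minimal number of directions among the
possible outputs of the generic facial reduction algorithm. -/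
def singularityDegree (P : Program E F) : ℕ∞ :=
  sInf {n : ℕ∞ | ∃ ds : List E, P.IsOutput ds ∧ n = (ds.length : ℕ∞)}

/-- Replacing `K` by `G` in the primal problem yields strong duality: the value of the new primal
problem is the dual optimal value, and it is attained if this value is finite. -/
def StrongDualityAt (P : Program E F) (G : Set E) : Prop :=
  P.primalValue G = P.dualValue ∧
    (P.dualValue ≠ ⊥ → P.dualValue ≠ ⊤ →
      ∃ x ∈ P.primalFeasible G, ((⟪P.c, x⟫_ℝ : ℝ) : EReal) = P.primalValue G)

/-- The distance to strong duality of the dual problem: the minimal number of facial reduction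
steps that ensure strong duality (`⊤` if no number of steps does). -/
def distStrongDuality (P : Program E F) : ℕ∞ :=
  sInf {n : ℕ∞ | ∃ (ds : List E) (G : Set E),
    P.FacialReduction ds G ∧ P.StrongDualityAt G ∧ n = (ds.length : ℕ∞)}

end Program

/-- The product `S × T`, inside the product space with inner product
`⟪x.1, y.1⟫ + ⟪x.2, y.2⟫`. -/
def prodSet {E : Type*} (S T : Set E) : Set (WithLp 2 (E × E)) :=
  {z | z.fst ∈ S ∧ z.snd ∈ T}

section Duplication

variable {E F : Type*} [NormedAddCommGroup E] [InnerProductSpace ℝ E]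
  [NormedAddCommGroup F] [InnerProductSpace ℝ F]

/-- The closed convex cone `K₁ × K₂`. -/
def prodCone (K₁ K₂ : ProperCone ℝ E) : ProperCone ℝ (WithLp 2 (E × E)) :=
  K₁.comap (WithLp.fstL 2 ℝ E E) ⊓ K₂.comap (WithLp.sndL 2 ℝ E E)

theorem coe_prodCone (K₁ K₂ : ProperCone ℝ E) :
    (prodCone K₁ K₂ : Set (WithLp 2 (E × E))) = prodSet (K₁ : Set E) (K₂ : Set E) := rfl

/-- The problem over `K₁ ∩ K₂`. -/
def interProgram (K₁ K₂ : ProperCone ℝ E) (A : E →ₗ[ℝ] F) (b : F) (c : E) : Program E F where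
  K := K₁ ⊓ K₂
  A := A
  b := b
  c := c

/-- The duplicated problem over `K₁ × K₂`: the primal problem is
`inf {⟪c, x₁ + x₂⟫ | A (x₁ + x₂) = b, (x₁, x₂) ∈ K₁* × K₂*}` and the dual problem is
`sup {⟪b, y⟫ | (c - Aᵀ y, c - Aᵀ y) ∈ K₁ × K₂}`. -/
def dupProgram (K₁ K₂ : ProperCone ℝ E) (A : E →ₗ[ℝ] F) (b : F) (c : E) :
    Program (WithLp 2 (E × E)) F where
  K := prodCone K₁ K₂
  A := A ∘ₗ (WithLp.fstₗ 2 ℝ E E + WithLp.sndₗ 2 ℝ E E)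
  b := b
  c := WithLp.toLp 2 (c, c)

/-- The adjoint of `(x₁, x₂) ↦ A (x₁ + x₂)` is `y ↦ (Aᵀ y, Aᵀ y)`, so that the slacks of the
duplicated dual problem are indeed the pairs `(c - Aᵀ y, c - Aᵀ y)`. -/
theorem dupProgram_slack [FiniteDimensional ℝ E] [FiniteDimensional ℝ F]
    (K₁ K₂ : ProperCone ℝ E) (A : E →ₗ[ℝ] F) (b : F) (c : E) (y : F) :
    (dupProgram K₁ K₂ A b c).c - LinearMap.adjoint (dupProgram K₁ K₂ A b c).A y =
      WithLp.toLp 2 (c - LinearMap.adjoint A y, c - LinearMap.adjoint A y) := by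
  have h : LinearMap.adjoint (dupProgram K₁ K₂ A b c).A y =
      WithLp.toLp 2 (LinearMap.adjoint A y, LinearMap.adjoint A y) := by
    refine ext_inner_right ℝ fun z => ?_
    rw [LinearMap.adjoint_inner_left]
    simp [dupProgram, LinearMap.adjoint_inner_left, inner_add_right]
  rw [h]
  rfl

end Duplication

end ConicLP

end

open scoped InnerProductSpace

noncomputable section

namespace ConicLP

/-! The minimal face consists of the points x of the cone such that s - εx stays in the cone for
some feasible slack s and some ε > 0 (`minFace_eq_radialFace`). Slacks of the duplicated problem are
diagonal, and averaging two of them shows that the condition can be checked in each factor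
separately. So its minimal face is a product, and the diagonal of that product is the minimal face
over the intersection.

The two problems are compared by sending a direction (d¹, d²) to d¹ + d² and a face to its diagonal
trace (`exists_facialReduction_diag`). A direction that cuts nothing off the diagonal is dropped, so
runs never get longer.

The upper bounds come from facial reduction that treats polyhedral factors as mere inequalities. At
a face C × D, either a Slater condition holds that asks only feasibility of the polyhedral factors,
or some direction certifies infeasibility or properly cuts a nonpolyhedral factor (`alternative`,
`partialSlater_or_exists_direction`). Each such cut lowers the sum of the two distances to
polyhedrality, which bounds the number of steps. Under the Slater condition strong duality holds
(`exists_primal_of_slater`), and at most one more direction completes the run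
(`exists_strictly_complementary`). A certificate of infeasibility also costs one direction; this is
the summand 1.

For strong duality in the infeasible case with a primal point x, either the bound leaves room for
the final step, or C and D are both polyhedral. Then x splits along (C ∩ D)* = C* + D*, and the
primal value is already -∞ at C × D. -/

/-! ### Farkas' lemma. -/

/-- **Farkas' lemma** for finitely many linear functionals on a real vector space. -/
theorem farkas {ι W : Type*} [AddCommGroup W] [Module ℝ W] (s : Finset ι) (α : ι → W →ₗ[ℝ] ℝ)
    (γ : W →ₗ[ℝ] ℝ) (h : ∀ x, (∀ i ∈ s, 0 ≤ α i x) → 0 ≤ γ x) :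
    ∃ l : ι → ℝ, (∀ i, 0 ≤ l i) ∧ γ = ∑ i ∈ s, l i • α i := by
  classical
  induction s using Finset.induction_on generalizing α γ with
  | empty =>
    refine ⟨0, by simp, ?_⟩
    ext x
    have h1 := h x (by simp)
    have h2 := h (-x) (by simp)
    simp only [map_neg] at h2
    simp only [Finset.sum_empty, LinearMap.zero_apply]
    linarith
  | insert j s hj ih =>
    by_cases hs : ∀ x, (∀ i ∈ s, 0 ≤ α i x) → 0 ≤ γ x
    · obtain ⟨l, hl, hγ⟩ := ih α γ hs
      refine ⟨Function.update l j 0, fun i => ?_, ?_⟩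
      · by_cases hi : i = j
        · simp [hi]
        · simp [hi, hl]
      · rw [Finset.sum_insert hj, hγ]
        simp only [Function.update_self, zero_smul, zero_add]
        refine Finset.sum_congr rfl fun i hi => ?_
        rw [Function.update_of_ne (by rintro rfl; exact hj hi)]
    · push Not at hs
      obtain ⟨z, hz, hγz⟩ := hs
      have hjz : α j z < 0 := by
        by_contra hcon
        have := h z (by simpa using ⟨not_lt.mp hcon, hz⟩)
        linarith
      -- With the normalisation α j w = -1, the map x ↦ x + α j x • w projects onto the kernel of α
      -- j. The induction hypothesis is applied to the functionals composed with this projection.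
      obtain ⟨w, hw, hγw, hjw⟩ : ∃ w, (∀ i ∈ s, 0 ≤ α i w) ∧ γ w < 0 ∧ α j w = -1 := by
        refine ⟨(-α j z)⁻¹ • z, fun i hi => ?_, ?_, ?_⟩
        · rw [map_smul, smul_eq_mul]
          exact mul_nonneg (inv_nonneg.mpr (by linarith)) (hz i hi)
        · rw [map_smul, smul_eq_mul]
          exact mul_neg_of_pos_of_neg (inv_pos.mpr (by linarith)) hγz
        · rw [map_smul, smul_eq_mul]
          rw [inv_neg, neg_mul, inv_mul_cancel₀ hjz.ne]
      obtain ⟨l, hl, hγ⟩ := ih (fun i => α i + α i w • α j) (γ + γ w • α j) (by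
        intro x hx
        have := h (x + α j x • w) (by
          intro i hi
          rcases Finset.mem_insert.mp hi with rfl | hi
          · simp [hjw]
          · have := hx i hi
            simp only [LinearMap.add_apply, LinearMap.smul_apply, smul_eq_mul] at this
            simp only [map_add, map_smul, smul_eq_mul]
            linarith)
        simp only [map_add, map_smul, smul_eq_mul] at this
        simp only [LinearMap.add_apply, LinearMap.smul_apply, smul_eq_mul]
        linarith)
      -- The coefficient of α j is what remains after expanding the composed functionals; it is
      -- positive because γ w < 0.
      refine ⟨Function.update l j (∑ i ∈ s, l i * α i w - γ w), fun i => ?_, ?_⟩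
      · by_cases hi : i = j
        · subst hi
          rw [Function.update_self]
          have := Finset.sum_nonneg fun i hi => mul_nonneg (hl i) (hw i hi)
          linarith
        · simp [hi, hl]
      · have hsum : ∑ i ∈ s, Function.update l j (∑ i ∈ s, l i * α i w - γ w) i • α i =
            ∑ i ∈ s, l i • α i := by
          refine Finset.sum_congr rfl fun i hi => ?_
          rw [Function.update_of_ne (by rintro rfl; exact hj hi)]
        rw [Finset.sum_insert hj, hsum, Function.update_self]
        ext x
        have hx := congrArg (fun f => f x) hγ
        simp only [LinearMap.add_apply, LinearMap.smul_apply, LinearMap.sum_apply, smul_eq_mul,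
          mul_add, Finset.sum_add_distrib, ← mul_assoc, ← Finset.sum_mul] at hx ⊢
        linear_combination hx

theorem sub_smul_mem_of_le {V : Type*} [AddCommGroup V] [Module ℝ V]
    {N : PointedCone ℝ V} {s x : V} {ε δ : ℝ} (hs : s ∈ N)
    (h : s - ε • x ∈ N) (hδ : 0 < δ) (hle : δ ≤ ε) : s - δ • x ∈ N := by
  have hε : 0 < ε := hδ.trans_le hle
  have h1 := N.add_mem (N.smul_mem (div_nonneg hδ.le hε.le) h)
    (N.smul_mem (sub_nonneg.mpr ((div_le_one hε).mpr hle)) hs)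
  convert h1 using 1
  rw [smul_sub, smul_smul, div_mul_cancel₀ _ hε.ne', sub_smul, one_smul]
  abel

/-! ### Polyhedral cones, dual cones and relative interiors. -/

section InnerProductSpace

variable {V : Type*} [NormedAddCommGroup V] [InnerProductSpace ℝ V]

/-- The polyhedral cone defined by the finitely many inequalities `0 ≤ ⟪a, x⟫`, `a ∈ t`. -/
def polyCone (t : Finset V) : PointedCone ℝ V where
  carrier := {x | ∀ a ∈ t, 0 ≤ ⟪a, x⟫_ℝ}
  zero_mem' := by simp
  add_mem' hx hy a ha := by rw [inner_add_right]; exact add_nonneg (hx a ha) (hy a ha)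
  smul_mem' r x hx a ha := by
    rw [← Nonneg.coe_smul, inner_smul_right]; exact mul_nonneg r.2 (hx a ha)

theorem mem_polyCone {t : Finset V} {x : V} : x ∈ polyCone t ↔ ∀ a ∈ t, 0 ≤ ⟪a, x⟫_ℝ := Iff.rfl

theorem mem_dualCone {S : Set V} {d : V} : d ∈ dualCone S ↔ ∀ x ∈ S, 0 ≤ ⟪x, d⟫_ℝ := by
  simp [dualCone]

theorem sum_mem_dualCone_polyCone {t t' : Finset V} (h : t' ⊆ t) {l : V → ℝ} (hl : ∀ a, 0 ≤ l a) :
    ∑ a ∈ t', l a • a ∈ dualCone (polyCone t : Set V) := by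
  rw [mem_dualCone]
  intro x hx
  rw [inner_sum]
  refine Finset.sum_nonneg fun a ha => ?_
  rw [inner_smul_right, real_inner_comm]
  exact mul_nonneg (hl a) (hx a (h ha))

/-- The relative interior of a convex cone, described algebraically. -/
def coneRi (N : PointedCone ℝ V) : Set V := {s | s ∈ N ∧ ∀ x ∈ N, ∃ ε > (0 : ℝ), s - ε • x ∈ N}

theorem coneRi_add {N : PointedCone ℝ V} {s x : V} (hs : s ∈ coneRi N) (hx : x ∈ N) :
    s + x ∈ coneRi N := by
  refine ⟨N.add_mem hs.1 hx, fun z hz => ?_⟩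
  obtain ⟨ε, hε, h⟩ := hs.2 z hz
  exact ⟨ε, hε, by simpa [add_sub_right_comm] using N.add_mem h hx⟩

theorem coneRi_smul {N : PointedCone ℝ V} {s : V} (hs : s ∈ coneRi N) {r : ℝ} (hr : 0 < r) :
    r • s ∈ coneRi N := by
  refine ⟨N.smul_mem hr.le hs.1, fun z hz => ?_⟩
  obtain ⟨ε, hε, h⟩ := hs.2 z hz
  exact ⟨r * ε, mul_pos hr hε, by simpa [smul_sub, smul_smul] using N.smul_mem hr.le h⟩

/-- Moving from s slightly away from x stays in N, so a positive value of n at x would make n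
negative there. -/
theorem inner_eq_zero_of_mem_coneRi {N : PointedCone ℝ V} {s n : V} (hs : s ∈ coneRi N)
    (hn : n ∈ dualCone (N : Set V)) (h : ⟪s, n⟫_ℝ ≤ 0) {x : V} (hx : x ∈ N) : ⟪x, n⟫_ℝ = 0 := by
  rw [mem_dualCone] at hn
  obtain ⟨ε, hε, hsx⟩ := hs.2 x hx
  have h1 := hn _ hsx
  have h2 := hn x hx
  rw [inner_sub_left, inner_smul_left] at h1
  simp only [conj_trivial] at h1
  nlinarith

end InnerProductSpace

/-! ### Separation and theorems of alternatives for slacks. -/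

variable {V F : Type*} [NormedAddCommGroup V] [InnerProductSpace ℝ V] [FiniteDimensional ℝ V]
  [NormedAddCommGroup F] [InnerProductSpace ℝ F] [FiniteDimensional ℝ F]

theorem slack_inner (A : V →ₗ[ℝ] F) (c d : V) (y : F) :
    ⟪c - LinearMap.adjoint A y, d⟫_ℝ = ⟪c, d⟫_ℝ - ⟪A d, y⟫_ℝ := by
  rw [inner_sub_left, LinearMap.adjoint_inner_left, real_inner_comm (A d)]

/-- Farkas' lemma for an infeasible system of linear inequalities. -/
theorem farkas_infeasible (A : V →ₗ[ℝ] F) (c : V) (t : Finset V)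
    (h : ¬ ∃ y, c - LinearMap.adjoint A y ∈ polyCone t) :
    ∃ l : V → ℝ, (∀ a, 0 ≤ l a) ∧ A (∑ a ∈ t, l a • a) = 0 ∧ ⟪c, ∑ a ∈ t, l a • a⟫_ℝ < 0 := by
  -- Homogenisation: a pair (u, r) with r > 0 satisfying all inequalities gives the solution y =
  -- -u/r, so infeasibility means that they imply -r ≥ 0.
  obtain ⟨l, hl, hγ⟩ := farkas (W := F × ℝ) t
    (fun a => (innerₗ F (A a)).coprod (⟪c, a⟫_ℝ • LinearMap.id)) (-LinearMap.snd ℝ F ℝ) (by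
      rintro ⟨u, r⟩ hx
      by_contra hr
      have hr : 0 < r := by simpa using hr
      refine h ⟨-(r⁻¹ • u), fun a ha => ?_⟩
      have := hx a ha
      simp only [LinearMap.coprod_apply, innerₗ_apply_apply, LinearMap.smul_apply,
        LinearMap.id_apply, smul_eq_mul] at this
      rw [real_inner_comm, slack_inner, inner_neg_right, inner_smul_right]
      have h2 := mul_nonneg (inv_nonneg.mpr hr.le) this
      rw [mul_add, mul_left_comm, inv_mul_cancel₀ hr.ne'] at h2
      linarith)
  refine ⟨l, hl, ?_, ?_⟩
  · refine ext_inner_right ℝ fun u => ?_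
    have := congrArg (fun f => f (u, (0 : ℝ))) hγ
    simp only [LinearMap.neg_apply, LinearMap.snd_apply, LinearMap.sum_apply,
      LinearMap.smul_apply, LinearMap.coprod_apply, innerₗ_apply_apply] at this
    simp [sum_inner, inner_smul_left] at this ⊢
    linarith
  · have := congrArg (fun f => f ((0 : F), (1 : ℝ))) hγ
    simp [LinearMap.sum_apply] at this
    simp only [inner_sum, inner_smul_right]
    linarith

/-- The affine Farkas lemma: a linear inequality that holds on a nonempty polyhedron is a
consequence of the defining inequalities. -/
theorem farkas_feasible (A : V →ₗ[ℝ] F) (c : V) (t : Finset V) (y₀ : F)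
    (hy₀ : c - LinearMap.adjoint A y₀ ∈ polyCone t) (g : V)
    (h : ∀ y, c - LinearMap.adjoint A y ∈ polyCone t → 0 ≤ ⟪c - LinearMap.adjoint A y, g⟫_ℝ) :
    ∃ l : V → ℝ, (∀ a, 0 ≤ l a) ∧ A (g - ∑ a ∈ t, l a • a) = 0 ∧
      0 ≤ ⟪c, g - ∑ a ∈ t, l a • a⟫_ℝ := by
  obtain ⟨l, hl, hγ⟩ := farkas (W := F × ℝ) (Finset.insertNone t)
    (fun o => o.elim (LinearMap.snd ℝ F ℝ)
      fun a => (innerₗ F (A a)).coprod (⟪c, a⟫_ℝ • LinearMap.id))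
    ((innerₗ F (A g)).coprod (⟪c, g⟫_ℝ • LinearMap.id)) (by
      rintro ⟨u, r⟩ hx
      have hr : 0 ≤ r := hx none (by simp)
      have hx : ∀ a ∈ t, 0 ≤ ⟪A a, u⟫_ℝ + ⟪c, a⟫_ℝ * r := fun a ha => by
        simpa using hx (some a) (by simpa using ha)
      simp only [LinearMap.coprod_apply, innerₗ_apply_apply, LinearMap.smul_apply,
        LinearMap.id_apply, smul_eq_mul]
      -- Dehomogenising fails when r = 0. Perturbing by ε times the homogenised feasible point y₀
      -- makes the last coordinate positive, and then ε tends to 0.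
      have key : ∀ ε > 0, 0 ≤ ⟪A g, u⟫_ℝ + ⟪c, g⟫_ℝ * r + ε * ⟪c - LinearMap.adjoint A y₀, g⟫_ℝ := by
        intro ε hε
        have hrε : 0 < r + ε := by linarith
        have hf := h ((r + ε)⁻¹ • (ε • y₀ - u)) (fun a ha => by
          have h1 := hx a ha
          have h2 := hy₀ a ha
          rw [real_inner_comm, slack_inner] at h2 ⊢
          rw [inner_smul_right, inner_sub_right, inner_smul_right]
          have h3 := mul_nonneg (inv_nonneg.mpr hrε.le) (add_nonneg h1 (mul_nonneg hε.le h2))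
          refine h3.trans_eq ?_
          have := inv_mul_cancel₀ hrε.ne'
          linear_combination ⟪c, a⟫_ℝ * this)
        rw [slack_inner] at hf ⊢
        rw [inner_smul_right, inner_sub_right, inner_smul_right] at hf
        have h3 := mul_nonneg hrε.le hf
        refine h3.trans_eq ?_
        have := mul_inv_cancel₀ hrε.ne'
        linear_combination (⟪A g, u⟫_ℝ - ε * ⟪A g, y₀⟫_ℝ) * this
      have lim : Filter.Tendsto (fun ε : ℝ => ⟪A g, u⟫_ℝ + ⟪c, g⟫_ℝ * r +
          ε * ⟪c - LinearMap.adjoint A y₀, g⟫_ℝ) (nhdsWithin 0 (Set.Ioi 0))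
          (nhds (⟪A g, u⟫_ℝ + ⟪c, g⟫_ℝ * r + 0 * ⟪c - LinearMap.adjoint A y₀, g⟫_ℝ)) :=
        (Continuous.tendsto (by fun_prop) 0).mono_left nhdsWithin_le_nhds
      rw [zero_mul, add_zero] at lim
      exact ge_of_tendsto lim (Filter.eventually_of_mem self_mem_nhdsWithin key))
  refine ⟨fun a => l (some a), fun a => hl _, ?_, ?_⟩
  · refine ext_inner_right ℝ fun u => ?_
    have := congrArg (fun f => f (u, (0 : ℝ))) hγ
    simp [LinearMap.sum_apply, Finset.sum_insertNone] at this
    simp [sum_inner, inner_smul_left, inner_sub_left, this]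
  · have := congrArg (fun f => f ((0 : F), (1 : ℝ))) hγ
    simp [LinearMap.sum_apply, Finset.sum_insertNone] at this
    simp only [inner_sum, inner_smul_right, inner_sub_right]
    linarith [hl none]

/-- A linear subspace is a polyhedral cone, with inequalities given by orthogonal vectors. -/
theorem exists_polyCone_eq_submodule (W : Submodule ℝ V) :
    ∃ t : Finset V, (∀ a ∈ t, a ∈ Wᗮ) ∧ ∀ x, x ∈ polyCone t ↔ x ∈ W := by
  classical
  obtain ⟨T, hT⟩ := IsNoetherian.noetherian Wᗮ
  refine ⟨T ∪ T.image Neg.neg, fun a ha => ?_, fun x => ⟨fun hx => ?_, fun hx a ha => ?_⟩⟩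
  · rcases Finset.mem_union.mp ha with ha | ha
    · exact hT ▸ Submodule.subset_span ha
    · obtain ⟨a, ha', rfl⟩ := Finset.mem_image.mp ha
      exact neg_mem (hT ▸ Submodule.subset_span ha')
  · rw [← W.orthogonal_orthogonal, ← hT, Submodule.mem_orthogonal]
    intro u hu
    induction hu using Submodule.span_induction with
    | mem a ha =>
      have h1 := hx a (Finset.mem_union_left _ ha)
      have h2 := hx (-a) (Finset.mem_union_right _ (Finset.mem_image_of_mem _ ha))
      rw [inner_neg_left] at h2
      linarith
    | zero => simp
    | add u v _ _ hu hv => rw [inner_add_left, hu, hv, add_zero]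
    | smul r u _ hu => rw [inner_smul_left, hu, mul_zero]
  · have ha : a ∈ Wᗮ := by
      rcases Finset.mem_union.mp ha with ha | ha
      · exact hT ▸ Submodule.subset_span ha
      · obtain ⟨a, ha', rfl⟩ := Finset.mem_image.mp ha
        exact neg_mem (hT ▸ Submodule.subset_span ha')
    rw [Submodule.inner_left_of_mem_orthogonal hx ha]

/-- Separation of a convex set from the relative interior of a cone, inside the linear span of
the cone. -/
theorem exists_separation (N : PointedCone ℝ V) (M : Set V) (hM : Convex ℝ M) (hne : M.Nonempty)
    (hspan : M ⊆ Submodule.span ℝ (N : Set V)) (hdisj : ∀ m ∈ M, m ∉ coneRi N) :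
    ∃ f ∈ Submodule.span ℝ (N : Set V), f ≠ 0 ∧ f ∈ dualCone (N : Set V) ∧
      ∀ m ∈ M, ⟪m, f⟫_ℝ ≤ 0 := by
  -- Inside its span the cone has nonempty interior, so the Hahn-Banach theorem for an open convex
  -- set applies.
  set W := Submodule.span ℝ (N : Set V) with hW
  set N' : Set W := (W.subtype) ⁻¹' (N : Set V) with hN'
  have hNW : ∀ x ∈ N, x ∈ W := fun x hx => Submodule.subset_span hx
  have hconv : Convex ℝ N' := N.convex.linear_preimage _
  have hint : (interior N').Nonempty := by
    rw [hconv.interior_nonempty_iff_affineSpan_eq_top,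
      AffineSubspace.affineSpan_eq_top_iff_vectorSpan_eq_top_of_nonempty _ _ _
        ⟨0, by simp [hN']⟩]
    rw [vectorSpan_eq_span_vsub_set_right ℝ (show (0 : W) ∈ N' by simp [hN']), eq_top_iff]
    rintro ⟨x, hx⟩ -
    simp only [vsub_eq_sub, sub_zero, Set.image_id']
    have : Submodule.map W.subtype (Submodule.span ℝ N') = W := by
      rw [Submodule.map_span, hN', Submodule.coe_subtype,
        Set.image_preimage_eq_of_subset fun x hx => ⟨⟨x, hNW x hx⟩, rfl⟩]
    rw [← this] at hx
    obtain ⟨z, hz, rfl⟩ := hx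
    exact hz
  have hri : ∀ x ∈ interior N', (x : V) ∈ coneRi N := by
    intro x hx
    refine ⟨interior_subset (s := N') hx, fun z hz => ?_⟩
    have hc : Filter.Tendsto (fun ε : ℝ => x - ε • (⟨z, hNW z hz⟩ : W))
        (nhdsWithin 0 (Set.Ioi 0)) (nhds (x - (0 : ℝ) • (⟨z, hNW z hz⟩ : W))) :=
      (Continuous.tendsto (by fun_prop) 0).mono_left nhdsWithin_le_nhds
    rw [zero_smul, sub_zero] at hc
    obtain ⟨ε, h1, h2⟩ := ((hc.eventually (isOpen_interior.mem_nhds hx)).and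
      self_mem_nhdsWithin).exists
    exact ⟨ε, h2, interior_subset (s := N') h1⟩
  obtain ⟨f, u, hf, hfM⟩ := geometric_hahn_banach_open hconv.interior isOpen_interior
    (hM.linear_preimage W.subtype) (Set.disjoint_left.mpr fun x hx hxM => hdisj _ hxM (hri x hx))
  have hle : ∀ x ∈ N', f x ≤ u := by
    intro x hx
    have h1 := (hconv.closure_interior_eq_closure_of_nonempty_interior hint).ge (subset_closure hx)
    exact closure_minimal (t := {x | f x ≤ u}) (fun x hx => (hf x hx).le)
      (isClosed_le f.continuous continuous_const) h1
  have hu : 0 ≤ u := by simpa using hle 0 (by simp [hN'])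
  have hle0 : ∀ x ∈ N', f x ≤ 0 := by
    intro x hx
    by_contra! hpos
    have := hle (((u + 1) / f x) • x) (N.smul_mem (by positivity) hx)
    rw [map_smul, smul_eq_mul, div_mul_cancel₀ _ hpos.ne'] at this
    linarith
  set g : W := (InnerProductSpace.toDual ℝ W).symm f with hg
  have hgf : ∀ x : W, ⟪(x : V), -(g : V)⟫_ℝ = - f x := by
    intro x
    rw [inner_neg_right, ← Submodule.coe_inner, real_inner_comm, hg,
      InnerProductSpace.toDual_symm_apply]
  refine ⟨-(g : V), neg_mem g.2, ?_, ?_, ?_⟩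
  · intro h0
    obtain ⟨x, hx⟩ := hint
    obtain ⟨m, hm⟩ := hne
    have h1 := hgf x
    have h2 := hgf ⟨m, hspan hm⟩
    rw [h0, inner_zero_right] at h1 h2
    have h3 := hf x hx
    have h4 := hfM ⟨m, hspan hm⟩ hm
    linarith
  · rw [mem_dualCone]
    intro x hx
    rw [hgf ⟨x, hNW x hx⟩]
    linarith [hle0 ⟨x, hNW x hx⟩ hx]
  · intro m hm
    rw [hgf ⟨m, hspan hm⟩]
    linarith [hfM ⟨m, hspan hm⟩ hm]

/-- A theorem of alternatives for a partially polyhedral system: if no slack lies in the relative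
interior of `N` and in the polyhedral cone defined by `t`, then there is a direction which either
detects infeasibility or does not vanish on `N`. -/
theorem alternative (A : V →ₗ[ℝ] F) (c : V) (N : PointedCone ℝ V) (t : Finset V)
    (h : ¬ ∃ y, c - LinearMap.adjoint A y ∈ coneRi N ∧ c - LinearMap.adjoint A y ∈ polyCone t) :
    ∃ n q, n ∈ dualCone (N : Set V) ∧ q ∈ dualCone (polyCone t : Set V) ∧ A (n + q) = 0 ∧
      (⟪c, n + q⟫_ℝ < 0 ∨ (⟪c, n + q⟫_ℝ = 0 ∧ ∃ x ∈ N, ⟪x, n⟫_ℝ ≠ 0)) := by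
  classical
  obtain ⟨T, hTW, hT⟩ := exists_polyCone_eq_submodule (Submodule.span ℝ (N : Set V))
  have hT0 : ∀ a ∈ T, ∀ x ∈ N, ⟪x, a⟫_ℝ = 0 := fun a ha x hx =>
    Submodule.inner_right_of_mem_orthogonal (Submodule.subset_span hx) (hTW a ha)
  have hsum0 : ∀ l : V → ℝ, ∀ x ∈ N, ⟪x, ∑ a ∈ T \ t, l a • a⟫_ℝ = 0 := fun l x hx => by
    rw [inner_sum]
    refine Finset.sum_eq_zero fun a ha => ?_
    rw [inner_smul_right, hT0 a (Finset.sdiff_subset ha) x hx, mul_zero]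
  have hsplit : ∀ l : V → ℝ, ∑ a ∈ T ∪ t, l a • a =
      ∑ a ∈ T \ t, l a • a + ∑ a ∈ t, l a • a := fun l => by
    rw [← Finset.sum_union Finset.sdiff_disjoint, Finset.sdiff_union_self_eq_union]
  have hunion : ∀ x, x ∈ polyCone (T ∪ t) ↔ x ∈ Submodule.span ℝ (N : Set V) ∧ x ∈ polyCone t := by
    intro x
    rw [← hT]
    simp only [mem_polyCone, Finset.mem_union, or_imp, forall_and]
  -- The inequalities in T cut out the span of N. Their multipliers vanish on N, so they can be
  -- absorbed into n without changing its values there.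
  by_cases hM : ∃ y, c - LinearMap.adjoint A y ∈ polyCone (T ∪ t)
  · obtain ⟨y₀, hy₀⟩ := hM
    obtain ⟨f, hfW, hf0, hfN, hfM⟩ := exists_separation N
      {s | s ∈ polyCone (T ∪ t) ∧ ∃ y, s = c - LinearMap.adjoint A y} (by
        rintro _ ⟨h1, y, rfl⟩ _ ⟨h2, z, rfl⟩ a b ha hb hab
        refine ⟨(polyCone _).convex h1 h2 ha hb hab, a • y + b • z, ?_⟩
        rw [map_add, map_smul, map_smul, smul_sub, smul_sub, sub_add_sub_comm, ← add_smul, hab,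
          one_smul]) ⟨_, hy₀, y₀, rfl⟩ (fun s hs => ((hunion s).mp hs.1).1) (by
        rintro _ ⟨h1, y, rfl⟩ h2
        exact h ⟨y, h2, ((hunion _).mp h1).2⟩)
    obtain ⟨l, hl, hA, hc⟩ := farkas_feasible A c (T ∪ t) y₀ hy₀ (-f) (fun y hy => by
      rw [inner_neg_right]
      linarith [hfM _ ⟨hy, y, rfl⟩])
    rw [hsplit] at hA hc
    refine ⟨f + ∑ a ∈ T \ t, l a • a, ∑ a ∈ t, l a • a, ?_,
      sum_mem_dualCone_polyCone subset_rfl hl, ?_, ?_⟩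
    · rw [mem_dualCone] at hfN ⊢
      intro x hx
      rw [inner_add_right, hsum0 l x hx, add_zero]
      exact hfN x hx
    · rw [← neg_eq_zero, ← map_neg, ← hA]
      congr 1
      abel
    · have hc' : ⟪c, f + ∑ a ∈ T \ t, l a • a + ∑ a ∈ t, l a • a⟫_ℝ ≤ 0 := by
        rw [← neg_nonneg, ← inner_neg_right]
        convert hc using 2
        abel
      rcases hc'.lt_or_eq with h1 | h1
      · exact Or.inl h1
      · refine Or.inr ⟨h1, ?_⟩
        -- Otherwise f vanishes on N, hence on its span, to which f itself belongs.
        by_contra! hx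
        refine hf0 (inner_self_eq_zero (𝕜 := ℝ).mp ?_)
        have : ∀ x ∈ Submodule.span ℝ (N : Set V), ⟪x, f⟫_ℝ = 0 := by
          intro x hx'
          induction hx' using Submodule.span_induction with
          | mem x hxN =>
            have := hx x hxN
            rwa [inner_add_right, hsum0 l x hxN, add_zero] at this
          | zero => simp
          | add u v _ _ hu hv => rw [inner_add_left, hu, hv, add_zero]
          | smul r u _ hu => rw [inner_smul_left, hu, mul_zero]
        exact this f hfW
  · obtain ⟨l, hl, hA, hc⟩ := farkas_infeasible A c (T ∪ t) hM
    rw [hsplit] at hA hc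
    refine ⟨_, _, ?_, sum_mem_dualCone_polyCone subset_rfl hl, hA, Or.inl hc⟩
    rw [mem_dualCone]
    exact fun x hx => (hsum0 l x hx).ge

/-! ### Strong duality and strict complementarity under a partial Slater condition. -/

section Duality

variable {V F : Type*} [NormedAddCommGroup V] [InnerProductSpace ℝ V] [FiniteDimensional ℝ V]
  [NormedAddCommGroup F] [InnerProductSpace ℝ F] [FiniteDimensional ℝ F]

/-- Strong duality under the partially polyhedral Slater condition. -/
theorem exists_primal_of_slater (A : V →ₗ[ℝ] F) (b : F) (c : V) (N : PointedCone ℝ V)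
    (t : Finset V) (y₀ : F) (hN : c - LinearMap.adjoint A y₀ ∈ coneRi N)
    (ht : c - LinearMap.adjoint A y₀ ∈ polyCone t) (θ : ℝ)
    (hθ : ∀ y, c - LinearMap.adjoint A y ∈ N → c - LinearMap.adjoint A y ∈ polyCone t →
      ⟪b, y⟫_ℝ ≤ θ) :
    ∃ n q, n ∈ dualCone (N : Set V) ∧ q ∈ dualCone (polyCone t : Set V) ∧ A (n + q) = b ∧
      ⟪c, n + q⟫_ℝ ≤ θ := by
  classical
  -- The extra slack coordinate is ⟪b, y⟫ - θ. A slack in the relative interior of N × ℝ₊ would beat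
  -- the bound θ, so `alternative` applies and its last coordinate is the multiplier of b.
  let A' : WithLp 2 (V × ℝ) →ₗ[ℝ] F :=
    A ∘ₗ WithLp.fstₗ 2 ℝ V ℝ - (WithLp.sndₗ 2 ℝ V ℝ).smulRight b
  let c' : WithLp 2 (V × ℝ) := WithLp.toLp 2 (c, -θ)
  let N' : PointedCone ℝ (WithLp 2 (V × ℝ)) :=
    N.comap (WithLp.fstₗ 2 ℝ V ℝ) ⊓ (PointedCone.positive ℝ ℝ).comap (WithLp.sndₗ 2 ℝ V ℝ)
  let t' : Finset (WithLp 2 (V × ℝ)) := t.image fun a => WithLp.toLp 2 (a, 0)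
  have hN' : ∀ z, z ∈ N' ↔ z.fst ∈ N ∧ 0 ≤ z.snd := fun z => Iff.rfl
  have ht' : ∀ z, z ∈ polyCone t' ↔ z.fst ∈ polyCone t := by
    intro z
    simp [mem_polyCone, t', WithLp.prod_inner_apply]
  have hadj : ∀ y, LinearMap.adjoint A' y = WithLp.toLp 2 (LinearMap.adjoint A y, -⟪b, y⟫_ℝ) := by
    intro y
    refine ext_inner_right ℝ fun z => ?_
    rw [LinearMap.adjoint_inner_left]
    simp only [A', WithLp.prod_inner_apply, LinearMap.adjoint_inner_left, LinearMap.sub_apply,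
      inner_sub_right, LinearMap.comp_apply, LinearMap.smulRight_apply, inner_smul_right,
      WithLp.fstₗ_apply, WithLp.sndₗ_apply, real_inner_comm b y]
    simp [sub_eq_add_neg]
  obtain ⟨n, q, hn, hq, hA, hc⟩ := alternative A' c' N' t' (by
    rintro ⟨y, h1, h2⟩
    rw [ht', hadj] at h2
    obtain ⟨ε, hε, h3⟩ := h1.2 (WithLp.toLp 2 (0, 1)) ((hN' _).mpr (by simp))
    have h4 := ((hN' _).mp h3).2
    rw [hadj] at h4
    simp [c'] at h4
    have h5 := ((hN' _).mp h1.1).1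
    rw [hadj] at h5
    linarith [hθ y h5 h2])
  rw [mem_dualCone] at hn hq
  have hn1 : n.fst ∈ dualCone (N : Set V) := by
    rw [mem_dualCone]
    intro x hx
    simpa [WithLp.prod_inner_apply] using hn (WithLp.toLp 2 (x, 0)) ((hN' _).mpr (by simpa using hx))
  have hn2 : 0 ≤ n.snd := by
    simpa [WithLp.prod_inner_apply] using hn (WithLp.toLp 2 (0, 1)) ((hN' _).mpr (by simp))
  have hq1 : q.fst ∈ dualCone (polyCone t : Set V) := by
    rw [mem_dualCone]
    intro x hx
    simpa [WithLp.prod_inner_apply] using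
      hq (WithLp.toLp 2 (x, 0)) ((ht' _).mpr (by simpa using hx))
  have hq2 : q.snd = 0 := by
    have h1 := hq (WithLp.toLp 2 (0, 1)) ((ht' _).mpr (by simp))
    have h2 := hq (WithLp.toLp 2 (0, -1)) ((ht' _).mpr (by simp))
    simp [WithLp.prod_inner_apply] at h1 h2
    linarith
  have hA' : A (n.fst + q.fst) = n.snd • b := by
    simpa [A', sub_eq_zero, hq2] using hA
  have hc' : ⟪c', n + q⟫_ℝ = ⟪c, n.fst + q.fst⟫_ℝ - θ * n.snd := by
    simp [c', WithLp.prod_inner_apply, hq2]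
    ring
  rw [hc'] at hc
  have hle : ⟪c, n.fst + q.fst⟫_ℝ ≤ θ * n.snd := by
    rcases hc with h | h <;> linarith
  -- If the multiplier of b were zero, the certificate evaluated at the Slater slack would have to
  -- vanish there, hence n would vanish on all of N, which `alternative` excludes.
  have hpos : 0 < n.snd := by
    by_contra hcon
    have h0 : n.snd = 0 := le_antisymm (not_lt.mp hcon) hn2
    rw [h0, zero_smul] at hA'
    rw [h0, mul_zero, sub_zero] at hc
    have h1 := slack_inner A c (n.fst + q.fst) y₀
    rw [hA', inner_zero_left, sub_zero, inner_add_right] at h1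
    have h2 := mem_dualCone.mp hn1 _ hN.1
    have h3 := mem_dualCone.mp hq1 _ ht
    rcases hc with hc | ⟨hc, x, hx, hxn⟩
    · linarith
    · refine hxn ?_
      have := inner_eq_zero_of_mem_coneRi hN hn1 (by linarith) ((hN' x).mp hx).1
      simp [WithLp.prod_inner_apply, this, h0]
  refine ⟨n.snd⁻¹ • n.fst, n.snd⁻¹ • q.fst, ?_, ?_, ?_, ?_⟩
  · exact PointedCone.smul_mem _ (inv_nonneg.mpr hn2) hn1
  · exact PointedCone.smul_mem _ (inv_nonneg.mpr hn2) hq1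
  · rw [← smul_add, map_smul, hA', smul_smul, inv_mul_cancel₀ hpos.ne', one_smul]
  · rw [← smul_add, inner_smul_right, inv_mul_le_iff₀ hpos]
    linarith

/-- Under the partially polyhedral Slater condition, a single direction exposes a face that has a
slack in its relative interior. -/
theorem exists_strictly_complementary (A : V →ₗ[ℝ] F) (c : V) (N : PointedCone ℝ V)
    (t : Finset V) (y₀ : F) (hN : c - LinearMap.adjoint A y₀ ∈ coneRi N)
    (ht : c - LinearMap.adjoint A y₀ ∈ polyCone t) :
    ∃ d ∈ dualCone ((N ⊓ polyCone t : PointedCone ℝ V) : Set V), A d = 0 ∧ ⟪c, d⟫_ℝ = 0 ∧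
      ∃ y, c - LinearMap.adjoint A y ∈ N ∧ c - LinearMap.adjoint A y ∈ polyCone t ∧
        ∀ x ∈ N, x ∈ polyCone t → ⟪x, d⟫_ℝ = 0 → ∃ ε > (0 : ℝ),
          c - LinearMap.adjoint A y - ε • x ∈ N ∧
          c - LinearMap.adjoint A y - ε • x ∈ polyCone t := by
  classical
  -- Induction over the inequalities: each one is either strict at the current slack or an equality
  -- on the face exposed by the current d.
  have key : ∀ s ⊆ t, ∃ d, d ∈ dualCone ((N ⊓ polyCone t : PointedCone ℝ V) : Set V) ∧ A d = 0 ∧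
      ⟪c, d⟫_ℝ = 0 ∧ ∃ y, c - LinearMap.adjoint A y ∈ coneRi N ∧
        c - LinearMap.adjoint A y ∈ polyCone t ∧
        ∀ a ∈ s, 0 < ⟪a, c - LinearMap.adjoint A y⟫_ℝ ∨
          ∀ x ∈ N, x ∈ polyCone t → ⟪x, d⟫_ℝ = 0 → ⟪a, x⟫_ℝ = 0 := by
    intro s
    induction s using Finset.induction_on with
    | empty => exact fun _ => ⟨0, zero_mem _, by simp, by simp, y₀, hN, ht, by simp⟩
    | insert a s has ih =>
      intro hst
      rw [Finset.insert_subset_iff] at hst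
      obtain ⟨d, hd, hAd, hcd, y, hyN, hyt, hs⟩ := ih hst.2
      by_cases hJ : ∃ z, c - LinearMap.adjoint A z ∈ N ∧ c - LinearMap.adjoint A z ∈ polyCone t ∧
          0 < ⟪a, c - LinearMap.adjoint A z⟫_ℝ
      · obtain ⟨z, hzN, hzt, haz⟩ := hJ
        have hmid : c - LinearMap.adjoint A ((1 / 2 : ℝ) • y + (1 / 2 : ℝ) • z) =
            (1 / 2 : ℝ) • (c - LinearMap.adjoint A y) +
              (1 / 2 : ℝ) • (c - LinearMap.adjoint A z) := by
          rw [map_add, map_smul, map_smul]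
          module
        refine ⟨d, hd, hAd, hcd, (1 / 2 : ℝ) • y + (1 / 2 : ℝ) • z, ?_, ?_, ?_⟩
        · rw [hmid]
          exact coneRi_add (coneRi_smul hyN (by norm_num)) (N.smul_mem (by norm_num) hzN)
        · rw [hmid]
          exact add_mem (PointedCone.smul_mem _ (by norm_num) hyt)
            (PointedCone.smul_mem _ (by norm_num) hzt)
        · intro e he
          rw [hmid, inner_add_right, inner_smul_right, inner_smul_right]
          rcases Finset.mem_insert.mp he with rfl | he
          · left
            have := hyt e hst.1
            linarith
          · refine (hs e he).imp_left fun h => ?_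
            have := hzt e (hst.2 he)
            linarith
      · push Not at hJ
        -- No feasible slack makes a strict, so a has maximum at most 0 over them. A dual solution n
        -- + q of this maximisation makes n + q + a a direction orthogonal to c, and its summand a
        -- vanishes on the face it exposes.
        obtain ⟨n, q, hn, hq, hA, hc⟩ := exists_primal_of_slater A (-A a) c N t y hyN hyt (-⟪c, a⟫_ℝ)
          (fun z h1 h2 => by
            have := hJ z h1 h2
            rw [real_inner_comm, slack_inner] at this
            rw [inner_neg_left]
            linarith)
        have ha : a ∈ dualCone (polyCone t : Set V) := by
          rw [mem_dualCone]
          intro x hx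
          rw [real_inner_comm]
          exact hx a hst.1
        rw [mem_dualCone] at hn hq hd ha
        have hA0 : A (n + q + a) = 0 := by rw [map_add, hA, neg_add_cancel]
        have hc0 : ⟪c, n + q + a⟫_ℝ = 0 := by
          have h1 := slack_inner A c (n + q + a) y
          rw [hA0, inner_zero_left, sub_zero, inner_add_right, inner_add_right] at h1
          have h2 := hn _ hyN.1
          have h3 := hq _ hyt
          have h4 := ha _ hyt
          rw [inner_add_right] at h1 ⊢
          linarith
        have hnn : ∀ x ∈ N, x ∈ polyCone t → 0 ≤ ⟪x, n + q⟫_ℝ := fun x h1 h2 => by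
          rw [inner_add_right]
          exact add_nonneg (hn x h1) (hq x h2)
        refine ⟨d + (n + q + a), ?_, by rw [map_add, hAd, hA0, add_zero],
          by rw [inner_add_right, hcd, hc0, add_zero], y, hyN, hyt, ?_⟩
        · rw [mem_dualCone]
          intro x hx
          rw [inner_add_right, inner_add_right]
          have h1 := hd x hx
          have h2 := hnn x hx.1 hx.2
          have h3 := ha x hx.2
          linarith
        · intro e he
          rcases Finset.mem_insert.mp he with rfl | he
          · right
            intro x h1 h2 h3
            rw [inner_add_right, inner_add_right] at h3
            have h4 := hd x ⟨h1, h2⟩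
            have h5 := hnn x h1 h2
            have h6 := ha x h2
            rw [real_inner_comm]
            linarith
          · refine (hs e he).imp_right fun h x h1 h2 h3 => h x h1 h2 ?_
            rw [inner_add_right, inner_add_right] at h3
            have h4 := hd x ⟨h1, h2⟩
            have h5 := hnn x h1 h2
            have h6 := ha x h2
            linarith
  obtain ⟨d, hd, hAd, hcd, y, hyN, hyt, hs⟩ := key t subset_rfl
  refine ⟨d, hd, hAd, hcd, y, hyN.1, hyt, fun x hxN hxt hxd => ?_⟩
  have hev : ∀ a ∈ t, ∀ᶠ ε : ℝ in nhdsWithin 0 (Set.Ioi 0),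
      0 ≤ ⟪a, c - LinearMap.adjoint A y - ε • x⟫_ℝ := by
    intro a ha
    rcases hs a ha with h | h
    · have hc : Filter.Tendsto (fun ε : ℝ => ⟪a, c - LinearMap.adjoint A y - ε • x⟫_ℝ)
          (nhdsWithin 0 (Set.Ioi 0)) (nhds ⟪a, c - LinearMap.adjoint A y - (0 : ℝ) • x⟫_ℝ) :=
        (Continuous.tendsto (by fun_prop) 0).mono_left nhdsWithin_le_nhds
      rw [zero_smul, sub_zero] at hc
      exact (hc.eventually (lt_mem_nhds h)).mono fun _ h => h.le
    · refine Filter.Eventually.of_forall fun ε => ?_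
      rw [inner_sub_right, inner_smul_right, h x hxN hxt hxd, mul_zero, sub_zero]
      exact hyt a ha
  obtain ⟨ε₀, hε₀, hN₀⟩ := hyN.2 x hxN
  have hIoc : ∀ᶠ ε : ℝ in nhdsWithin 0 (Set.Ioi 0), ε ∈ Set.Ioc 0 ε₀ := Ioc_mem_nhdsGT hε₀
  -- The relative interior of N gives room in N, and finitely many strict inequalities give room in
  -- the polyhedral part; one ε serves both.
  obtain ⟨ε, ⟨hε, hεle⟩, hεt⟩ := (hIoc.and ((Filter.eventually_all_finset t).mpr hev)).exists
  exact ⟨ε, hε, sub_smul_mem_of_le hyN.1 hN₀ hε hεle, hεt⟩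

end Duality

/-! ### Faces of convex cones and the minimal face. -/

section Faces

variable {V : Type*} [AddCommGroup V] [Module ℝ V]

/-- For cones, segments can be traded for sums: u + v is the midpoint of 2u and 2v. -/
theorem isFace_iff {K C : PointedCone ℝ V} :
    IsFace (K : Set V) (C : Set V) ↔ C ≤ K ∧ ∀ u ∈ K, ∀ v ∈ K, u + v ∈ C → u ∈ C := by
  constructor
  · intro h
    refine ⟨h.1.subset, fun u hu v hv huv => ?_⟩
    have h2 := h.1.left_mem_of_mem_openSegment (K.smul_mem zero_le_two hu)
      (K.smul_mem zero_le_two hv) huv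
      ⟨1 / 2, 1 / 2, by norm_num, by norm_num, by norm_num, by module⟩
    simpa [smul_smul] using C.smul_mem (r := (1 / 2 : ℝ)) (by norm_num) h2
  · rintro ⟨hle, h⟩
    refine ⟨⟨hle, ?_⟩, C.convex⟩
    rintro u hu v hv _ hz ⟨a, b, ha, hb, -, rfl⟩
    have h1 := h _ (K.smul_mem ha.le hu) _ (K.smul_mem hb.le hv) hz
    simpa [smul_smul, inv_mul_cancel₀ ha.ne'] using C.smul_mem (inv_nonneg.mpr ha.le) h1

/-- A nonempty face of a convex cone is a convex cone. -/
theorem IsFace.exists_pointedCone {K : PointedCone ℝ V} {G : Set V} (h : IsFace (K : Set V) G)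
    (hne : G.Nonempty) : ∃ C : PointedCone ℝ V, (C : Set V) = G := by
  have h2 : ∀ z ∈ G, (2 : ℝ) • z ∈ G := fun z hz =>
    h.1.left_mem_of_mem_openSegment (K.smul_mem zero_le_two (h.1.subset hz)) K.zero_mem hz
      ⟨1 / 2, 1 / 2, by norm_num, by norm_num, by norm_num, by module⟩
  have h0 : (0 : V) ∈ G := by
    obtain ⟨z, hz⟩ := hne
    exact h.1.left_mem_of_mem_openSegment K.zero_mem (K.smul_mem zero_le_two (h.1.subset hz)) hz
      ⟨1 / 2, 1 / 2, by norm_num, by norm_num, by norm_num, by module⟩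
  refine ⟨⟨⟨⟨G, fun {x y} hx hy => ?_⟩, h0⟩, fun r x hx => ?_⟩, rfl⟩
  · have hmid : (1 / 2 : ℝ) • x + (1 / 2 : ℝ) • y ∈ G :=
      h.2 hx hy (by norm_num) (by norm_num) (by norm_num)
    have := h2 _ hmid
    rwa [smul_add, smul_smul, smul_smul, mul_one_div_cancel two_ne_zero, one_smul, one_smul] at this
  · obtain ⟨r, hr⟩ := r
    change r • x ∈ G
    rcases le_or_gt r 1 with hr1 | hr1
    · simpa using h.2 hx h0 hr (sub_nonneg.mpr hr1) (by ring)
    · have hr0 : 0 < r := by linarith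
      refine h.1.left_mem_of_mem_openSegment (K.smul_mem hr (h.1.subset hx)) K.zero_mem hx
        ⟨r⁻¹, 1 - r⁻¹, inv_pos.mpr hr0, sub_pos.mpr (inv_lt_one_of_one_lt₀ hr1), by ring, ?_⟩
      rw [smul_zero, add_zero, smul_smul, inv_mul_cancel₀ hr0.ne', one_smul]

theorem IsFace.trans {K G H : Set V} (h : IsFace K G) (h' : IsFace G H) : IsFace K H :=
  ⟨h.1.trans h'.1, h'.2⟩

theorem isFace_refl (C : PointedCone ℝ V) : IsFace (C : Set V) (C : Set V) :=
  ⟨IsExtreme.rfl, C.convex⟩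

/-- The points of `K` towards which some point of `S` can be moved away within `K`. -/
def radialFace (K : PointedCone ℝ V) (S : Set V) : Set V :=
  {x | x ∈ K ∧ ∃ s ∈ S, ∃ ε > (0 : ℝ), s - ε • x ∈ K}

theorem isFace_radialFace {K : PointedCone ℝ V} {S : Set V} (hS : Convex ℝ S)
    (hSK : S ⊆ (K : Set V)) : IsFace (K : Set V) (radialFace K S) := by
  refine ⟨⟨fun x hx => hx.1, ?_⟩, ?_⟩
  · rintro u hu v hv _ ⟨-, s, hs, ε, hε, h⟩ ⟨a, b, ha, hb, -, rfl⟩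
    refine ⟨hu, s, hs, ε * a, mul_pos hε ha, ?_⟩
    have := K.add_mem h (K.smul_mem (mul_nonneg hε.le hb.le) hv)
    convert this using 1
    module
  · rintro x ⟨hx, s, hs, ε, hε, h⟩ x' ⟨hx', s', hs', ε', hε', h'⟩ a b ha hb hab
    refine ⟨K.convex hx hx' ha hb hab, a • s + b • s', hS hs hs' ha hb hab, min ε ε',
      lt_min hε hε', ?_⟩
    have := K.convex (sub_smul_mem_of_le (hSK hs) h (lt_min hε hε') (min_le_left _ _))
      (sub_smul_mem_of_le (hSK hs') h' (lt_min hε hε') (min_le_right _ _)) ha hb hab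
    rw [SetLike.mem_coe] at this
    convert this using 1
    module

/-- A face containing s = εx + (s - εx) contains both summands. This explicit form is what makes
minimal faces computable on products and on the diagonal. -/
theorem minFace_eq_radialFace {K : PointedCone ℝ V} {S : Set V} (hS : Convex ℝ S)
    (hSK : S ⊆ (K : Set V)) : minFace (K : Set V) S = radialFace K S := by
  refine Set.Subset.antisymm (Set.sInter_subset_of_mem ⟨isFace_radialFace hS hSK, fun s hs =>
    ⟨hSK hs, s, hs, 1, one_pos, by simp⟩⟩) ?_
  rintro x ⟨hx, s, hs, ε, hε, h⟩ G ⟨hG, hSG⟩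
  obtain ⟨C, rfl⟩ := hG.exists_pointedCone ⟨s, hSG hs⟩
  have := (isFace_iff.mp hG).2 (ε • x) (K.smul_mem hε.le hx) _ h (by simpa using hSG hs)
  simpa [smul_smul, inv_mul_cancel₀ hε.ne'] using C.smul_mem (inv_nonneg.mpr hε.le) this

end Faces

/-! ### Exposed faces, chains of faces and the distance to polyhedrality. -/

section Polyhedrality

variable {V : Type*} [NormedAddCommGroup V] [InnerProductSpace ℝ V]

/-- The face exposed by a vector of the dual cone. -/
def exposedFace (C : PointedCone ℝ V) (d : V) : PointedCone ℝ V where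
  carrier := {x | x ∈ C ∧ ⟪x, d⟫_ℝ = 0}
  zero_mem' := by simp
  add_mem' hx hy := ⟨C.add_mem hx.1 hy.1, by rw [inner_add_left, hx.2, hy.2, add_zero]⟩
  smul_mem' r x hx := ⟨C.smul_mem r.2 hx.1, by
    rw [← Nonneg.coe_smul, inner_smul_left, hx.2, mul_zero]⟩

theorem mem_exposedFace {C : PointedCone ℝ V} {d x : V} :
    x ∈ exposedFace C d ↔ x ∈ C ∧ ⟪x, d⟫_ℝ = 0 := Iff.rfl

theorem isFace_exposedFace {C : PointedCone ℝ V} {d : V} (hd : d ∈ dualCone (C : Set V)) :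
    IsFace (C : Set V) (exposedFace C d : Set V) := by
  rw [mem_dualCone] at hd
  refine isFace_iff.mpr ⟨fun x hx => hx.1, fun u hu v hv huv => ⟨hu, ?_⟩⟩
  have := huv.2
  rw [inner_add_left] at this
  linarith [hd u hu, hd v hv]

theorem IsPolyhedralityChain.le_distPoly {K : Set V} {k : ℕ} {G : Fin (k + 1) → Set V}
    (h : IsPolyhedralityChain K k G) : (k : ℕ∞) ≤ distPoly K :=
  le_sSup ⟨k, rfl, G, h⟩

theorem IsFace.distPoly_le {K G : Set V} (h : IsFace K G) : distPoly G ≤ distPoly K := by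
  refine sSup_le ?_
  rintro _ ⟨k, rfl, H, hH⟩
  exact IsPolyhedralityChain.le_distPoly
    ⟨hH.strictMono, fun i => h.trans (hH.isFace i), hH.nonempty, hH.polyhedral_zero,
      hH.not_polyhedral⟩

theorem IsPolyhedralityChain.snoc {K G : Set V} {k : ℕ} {H : Fin (k + 1) → Set V}
    (h : IsPolyhedralityChain G k H) (hG : IsFace K G) (hK : IsFace K K) (hne : G ≠ K)
    (hpoly : ¬ IsPolyhedralCone K) :
    IsPolyhedralityChain K (k + 1) (Fin.snoc (α := fun _ => Set V) H K) where
  strictMono := by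
    have hlt : ∀ i, H i ⊂ K := fun i =>
      ((h.isFace i).1.subset).trans_ssubset (hG.1.subset.ssubset_of_ne hne)
    intro i j hij
    induction j using Fin.lastCases with
    | last =>
      induction i using Fin.lastCases with
      | last => exact absurd hij (lt_irrefl _)
      | cast i => simpa using hlt i
    | cast j =>
      induction i using Fin.lastCases with
      | last => exact absurd hij (not_lt.mpr (Fin.le_last _))
      | cast i => simpa using h.strictMono (Fin.castSucc_lt_castSucc_iff.mp hij)
  isFace i := by
    induction i using Fin.lastCases with
    | last => simpa using hK
    | cast i => simpa using hG.trans (h.isFace i)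
  nonempty i := by
    induction i using Fin.lastCases with
    | last => simpa using (h.nonempty 0).mono ((h.isFace 0).1.subset.trans hG.1.subset)
    | cast i => simpa using h.nonempty i
  polyhedral_zero := by
    rw [← Fin.castSucc_zero, Fin.snoc_castSucc]
    exact h.polyhedral_zero
  not_polyhedral i hi := by
    induction i using Fin.lastCases with
    | last => simpa using hpoly
    | cast i =>
      rw [Fin.snoc_castSucc]
      exact h.not_polyhedral i (by rintro rfl; exact hi rfl)

/-- The lineality space is a polyhedral face of every cone, so it can always start a chain. -/
theorem isFace_lineal (C : PointedCone ℝ V) : IsFace (C : Set V) (C.lineal : Set V) := by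
  refine (isFace_iff (C := (C.lineal : PointedCone ℝ V))).mpr
    ⟨C.lineal_le, fun u hu v hv huv => ⟨hu, ?_⟩⟩
  have := C.add_mem huv.2 hv
  change -u ∈ C
  convert this using 1
  simp

/-- Writing x = u - v with u and v in C gives x + v = u in C, and a face contains the summands. Thus
spans strictly grow along a chain of faces, so the dimension bounds its length. -/
theorem IsFace.mem_of_mem_span {K C : PointedCone ℝ V} (h : IsFace (K : Set V) (C : Set V)) {x : V}
    (hx : x ∈ K) (hxC : x ∈ Submodule.span ℝ (C : Set V)) : x ∈ C := by
  have hdiff : ∀ z ∈ Submodule.span ℝ (C : Set V), ∃ u ∈ C, ∃ v ∈ C, z = u - v := by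
    intro z hz
    induction hz using Submodule.span_induction with
    | mem z hz => exact ⟨z, hz, 0, C.zero_mem, by simp⟩
    | zero => exact ⟨0, C.zero_mem, 0, C.zero_mem, by simp⟩
    | add y z _ _ hy hz =>
      obtain ⟨u, hu, v, hv, rfl⟩ := hy
      obtain ⟨u', hu', v', hv', rfl⟩ := hz
      exact ⟨u + u', C.add_mem hu hu', v + v', C.add_mem hv hv', by abel⟩
    | smul r z _ hz =>
      obtain ⟨u, hu, v, hv, rfl⟩ := hz
      rcases le_total 0 r with hr | hr
      · exact ⟨r • u, C.smul_mem hr hu, r • v, C.smul_mem hr hv, smul_sub _ _ _⟩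
      · exact ⟨(-r) • v, C.smul_mem (neg_nonneg.mpr hr) hv, (-r) • u,
          C.smul_mem (neg_nonneg.mpr hr) hu, by module⟩
  obtain ⟨u, hu, v, hv, rfl⟩ := hdiff x hxC
  rw [isFace_iff] at h
  exact h.2 _ hx v (h.1 hv) (by simpa using hu)

/-- The dual of an intersection of polyhedral cones is the sum of their duals. -/
theorem IsPolyhedralCone.exists_add_of_mem_dualCone_inter {G H : Set V} (hG : IsPolyhedralCone G)
    (hH : IsPolyhedralCone H) {x : V} (hx : x ∈ dualCone (G ∩ H)) :
    ∃ u ∈ dualCone G, ∃ v ∈ dualCone H, u + v = x := by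
  classical
  obtain ⟨s, rfl⟩ := hG
  obtain ⟨t, rfl⟩ := hH
  rw [mem_dualCone] at hx
  obtain ⟨l, hl, h⟩ := farkas (s ∪ t) (fun a => innerₗ V a) (innerₗ V x) (fun z hz => by
    rw [innerₗ_apply_apply, real_inner_comm]
    exact hx z ⟨fun a ha => hz a (Finset.mem_union_left _ ha),
      fun a ha => hz a (Finset.mem_union_right _ ha)⟩)
  refine ⟨∑ a ∈ s \ t, l a • a, sum_mem_dualCone_polyCone (t := s) Finset.sdiff_subset hl,
    ∑ a ∈ t, l a • a, sum_mem_dualCone_polyCone (t := t) subset_rfl hl, ?_⟩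
  rw [← Finset.sum_union Finset.sdiff_disjoint, Finset.sdiff_union_self_eq_union]
  refine ext_inner_right ℝ fun z => ?_
  have := congrArg (fun f => f z) h
  simpa [LinearMap.sum_apply, sum_inner, inner_smul_left] using this.symm

variable [FiniteDimensional ℝ V]

theorem isPolyhedralCone_submodule (W : Submodule ℝ V) : IsPolyhedralCone (W : Set V) := by
  obtain ⟨t, -, ht⟩ := exists_polyCone_eq_submodule W
  exact ⟨t, Set.ext fun x => (ht x).symm⟩

theorem exists_isPolyhedralityChain_zero (C : PointedCone ℝ V) :
    IsPolyhedralityChain (C : Set V) 0 fun _ => (C.lineal : Set V) where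
  strictMono := fun i j hij => absurd hij (by omega)
  isFace _ := isFace_lineal C
  nonempty _ := ⟨0, C.lineal.zero_mem⟩
  polyhedral_zero := isPolyhedralCone_submodule _
  not_polyhedral i hi := absurd (by omega) hi

/-- The distance to polyhedrality of a proper face of a nonpolyhedral cone is strictly smaller. -/
theorem distPoly_add_one_le {C : PointedCone ℝ V} {G : PointedCone ℝ V}
    (hG : IsFace (C : Set V) (G : Set V)) (hne : (G : Set V) ≠ C)
    (hpoly : ¬ IsPolyhedralCone (C : Set V)) :
    distPoly (G : Set V) + 1 ≤ distPoly (C : Set V) := by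
  have key : ∀ (k : ℕ) (H : Fin (k + 1) → Set V), IsPolyhedralityChain (G : Set V) k H →
      (k : ℕ∞) + 1 ≤ distPoly (C : Set V) := fun k H hH => by
    simpa using (hH.snoc hG (isFace_refl C) hne hpoly).le_distPoly
  -- Needed so that the truncated subtraction below can be undone.
  have h1 : (1 : ℕ∞) ≤ distPoly (C : Set V) := by
    simpa using key 0 _ (exists_isPolyhedralityChain_zero G)
  have h2 : distPoly (G : Set V) ≤ distPoly (C : Set V) - 1 := by
    refine sSup_le ?_
    rintro _ ⟨k, rfl, H, hH⟩
    exact ENat.le_sub_of_add_le_right ENat.one_ne_top (key k H hH)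
  calc distPoly (G : Set V) + 1 ≤ distPoly (C : Set V) - 1 + 1 := by gcongr
    _ = distPoly (C : Set V) := tsub_add_cancel_of_le h1

theorem one_le_distPoly {C : PointedCone ℝ V} (hpoly : ¬ IsPolyhedralCone (C : Set V)) :
    1 ≤ distPoly (C : Set V) :=
  le_add_self.trans (distPoly_add_one_le (G := (C.lineal : PointedCone ℝ V)) (isFace_lineal C)
    (fun h => hpoly (h ▸ isPolyhedralCone_submodule C.lineal)) hpoly)

/-- The distance to polyhedrality of a cone is finite. -/
theorem distPoly_lt_top (K : PointedCone ℝ V) : distPoly (K : Set V) < ⊤ := by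
  refine lt_of_le_of_lt (sSup_le ?_) (ENat.natCast_lt_top (Module.finrank ℝ V))
  rintro _ ⟨k, rfl, H, hH⟩
  have hmono : StrictMono fun i => Module.finrank ℝ (Submodule.span ℝ (H i)) := by
    intro i j hij
    refine Submodule.finrank_lt_finrank_of_lt
      (lt_of_le_of_ne (Submodule.span_mono (hH.strictMono hij).le) fun heq => ?_)
    obtain ⟨C, hC⟩ := (hH.isFace i).exists_pointedCone (hH.nonempty i)
    refine (hH.strictMono hij).not_ge fun x hx => ?_
    rw [← hC]
    refine (hC ▸ hH.isFace i : IsFace (K : Set V) (C : Set V)).mem_of_mem_span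
      ((hH.isFace j).1.subset hx) ?_
    rw [hC, heq]
    exact Submodule.subset_span hx
  have hinj : Function.Injective fun i : Fin (k + 1) =>
      (⟨Module.finrank ℝ (Submodule.span ℝ (H i)),
        Nat.lt_succ_of_le (Submodule.finrank_le _)⟩ : Fin (Module.finrank ℝ V + 1)) :=
    fun i j hij => hmono.injective (Fin.mk.inj hij)
  have := Fintype.card_le_of_injective _ hinj
  simp only [Fintype.card_fin] at this
  exact_mod_cast Nat.le_of_succ_le_succ this

end Polyhedrality

/-! ### The whole space as a cone. -/

section FullCone

variable {V : Type*} [NormedAddCommGroup V] [InnerProductSpace ℝ V]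

theorem eq_zero_of_mem_dualCone_top {d : V}
    (h : d ∈ dualCone ((⊤ : PointedCone ℝ V) : Set V)) : d = 0 := by
  have h1 := mem_dualCone.mp h (-d) trivial
  rw [inner_neg_left] at h1
  exact inner_self_eq_zero (𝕜 := ℝ).mp (le_antisymm (by simpa using h1) real_inner_self_nonneg)

theorem polyCone_empty : polyCone (∅ : Finset V) = ⊤ := by
  ext x
  simp [mem_polyCone]

end FullCone

/-! ### Facial reduction, weak and strong duality for a single program. -/

namespace Program

variable {V F : Type*} [NormedAddCommGroup V] [InnerProductSpace ℝ V] [FiniteDimensional ℝ V]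
  [NormedAddCommGroup F] [InnerProductSpace ℝ F] [FiniteDimensional ℝ F] {P : Program V F}

theorem convex_feasibleSlacks (P : Program V F) : Convex ℝ P.feasibleSlacks := by
  rintro _ ⟨h1, y, rfl⟩ _ ⟨h2, z, rfl⟩ a b ha hb hab
  refine ⟨P.K.convex h1 h2 ha hb hab, a • y + b • z, ?_⟩
  rw [map_add, map_smul, map_smul, smul_sub, smul_sub, sub_add_sub_comm, ← add_smul, hab, one_smul]

theorem dualMinFace_eq (P : Program V F) :
    P.dualMinFace = radialFace (P.K : PointedCone ℝ V) P.feasibleSlacks :=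
  minFace_eq_radialFace (K := (P.K : PointedCone ℝ V)) P.convex_feasibleSlacks fun _ h => h.1

theorem inner_feasibleSlacks {s d : V} (hs : s ∈ P.feasibleSlacks) (hd : P.A d = 0) :
    ⟪s, d⟫_ℝ = ⟪P.c, d⟫_ℝ := by
  obtain ⟨-, y, rfl⟩ := hs
  rw [slack_inner, hd, inner_zero_left, sub_zero]

omit [FiniteDimensional ℝ V] [FiniteDimensional ℝ F] in
theorem IsOutput.singularityDegree_le {ds : List V} (h : P.IsOutput ds) :
    P.singularityDegree ≤ ds.length :=
  sInf_le ⟨ds, h, rfl⟩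

theorem StrongDualityAt.distStrongDuality_le {ds : List V} {G : Set V}
    (h : P.StrongDualityAt G) (hFR : P.FacialReduction ds G) : P.distStrongDuality ≤ ds.length :=
  sInf_le ⟨ds, G, hFR, h, rfl⟩

omit [FiniteDimensional ℝ V] [FiniteDimensional ℝ F] in
theorem FacialReduction.subset {ds : List V} {G : Set V} (h : P.FacialReduction ds G) :
    G ⊆ (P.K : Set V) := by
  induction h with
  | start => exact subset_rfl
  | reduce ds G d hG hd hA hc hperp ih => exact Set.inter_subset_left.trans ih
  | infeasible ds G d hG hne hd hA hc ih => exact Set.empty_subset _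

omit [FiniteDimensional ℝ V] [FiniteDimensional ℝ F] in
theorem FacialReduction.eq_empty_or_pointedCone {ds : List V} {G : Set V}
    (h : P.FacialReduction ds G) : G = ∅ ∨ ∃ C : PointedCone ℝ V, (C : Set V) = G := by
  induction h with
  | start => exact Or.inr ⟨(P.K : PointedCone ℝ V), rfl⟩
  | reduce ds G d hG hd hA hc hperp ih =>
    rcases ih with rfl | ⟨C, rfl⟩
    · exact Or.inl (Set.empty_inter _)
    · exact Or.inr ⟨exposedFace C d, rfl⟩
  | infeasible ds G d hG hne hd hA hc ih => exact Or.inl rfl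

/-- A direction in ker A has the same inner product with every slack as with c, so a reducing step
cuts off no slack and an infeasible step contradicts the existence of one. -/
theorem FacialReduction.feasibleSlacks_subset {ds : List V} {G : Set V}
    (h : P.FacialReduction ds G) : P.feasibleSlacks ⊆ G := by
  induction h with
  | start => exact fun s hs => hs.1
  | reduce ds G d hG hd hA hc hperp ih =>
    exact fun s hs => ⟨ih hs, by rw [Set.mem_ofPred_eq, inner_feasibleSlacks hs hA, hc]⟩
  | infeasible ds G d hG hne hd hA hc ih =>
    intro s hs
    have := mem_dualCone.mp hd s (ih hs)
    rw [inner_feasibleSlacks hs hA] at this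
    exact absurd hc (not_lt.mpr this)

/-- Weak duality. -/
theorem dualValue_le_primalValue {G : Set V} (hG : P.feasibleSlacks ⊆ G) :
    P.dualValue ≤ P.primalValue G := by
  refine iSup₂_le fun y hy => le_iInf₂ fun x hx => ?_
  have h1 := mem_dualCone.mp hx.2 _ (hG ⟨hy, y, rfl⟩)
  rw [slack_inner, hx.1] at h1
  exact EReal.coe_le_coe_iff.mpr (by linarith)

/-- A direction of infeasibility yields strong duality, with both values equal to `-∞`, as soon as
the primal problem is feasible. -/
theorem strongDualityAt_of_infeasible {G : Set V} (hG : P.feasibleSlacks ⊆ G) {d x : V}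
    (hd : d ∈ dualCone G) (hA : P.A d = 0) (hc : ⟪P.c, d⟫_ℝ < 0) (hx : x ∈ P.primalFeasible G) :
    P.StrongDualityAt G := by
  have hbot : P.primalValue G = ⊥ := by
    rw [EReal.eq_bot_iff_forall_lt]
    intro r
    -- Chosen so that the objective at x + k • d is at most r - 1.
    set k : ℝ := max 0 ((r - 1 - ⟪P.c, x⟫_ℝ) / ⟪P.c, d⟫_ℝ)
    have hk : (r - 1 - ⟪P.c, x⟫_ℝ) / ⟪P.c, d⟫_ℝ ≤ k := le_max_right _ _
    rw [div_le_iff_of_neg hc] at hk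
    have hxk : x + k • d ∈ P.primalFeasible G :=
      ⟨by rw [map_add, map_smul, hA, smul_zero, add_zero, hx.1],
        add_mem hx.2 (PointedCone.smul_mem _ (le_max_left _ _) hd)⟩
    refine lt_of_le_of_lt (iInf₂_le (x + k • d) hxk) ?_
    · rw [EReal.coe_lt_coe_iff, inner_add_right, inner_smul_right]
      linarith
  have hdual : P.dualValue = ⊥ := le_bot_iff.mp (hbot ▸ dualValue_le_primalValue hG)
  exact ⟨hbot.trans hdual.symm, fun h => absurd hdual h⟩

/-- The partially polyhedral Slater condition for the cone `C`: it is the intersection of a cone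
`N` and a polyhedral cone, which contains a slack in the relative interior of `N`. -/
def PartialSlater (P : Program V F) (C : PointedCone ℝ V) : Prop :=
  ∃ (N : PointedCone ℝ V) (t : Finset V) (y : F), C = N ⊓ polyCone t ∧
    P.c - LinearMap.adjoint P.A y ∈ coneRi N ∧ P.c - LinearMap.adjoint P.A y ∈ polyCone t

theorem PartialSlater.strongDualityAt {C : PointedCone ℝ V} (h : P.PartialSlater C)
    (hG : P.feasibleSlacks ⊆ (C : Set V)) (hK : (C : Set V) ⊆ P.K) :
    P.StrongDualityAt (C : Set V) := by
  obtain ⟨N, t, y₀, rfl, hN, ht⟩ := h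
  have hweak := dualValue_le_primalValue hG
  have key : P.dualValue ≠ ⊤ → ∃ x ∈ P.primalFeasible ((N ⊓ polyCone t : PointedCone ℝ V) : Set V),
      ((⟪P.c, x⟫_ℝ : ℝ) : EReal) ≤ P.dualValue := by
    intro htop
    have hle : ∀ y ∈ P.dualFeasible, ((⟪P.b, y⟫_ℝ : ℝ) : EReal) ≤ P.dualValue :=
      fun y hy => le_iSup₂ (f := fun y _ => ((⟪P.b, y⟫_ℝ : ℝ) : EReal)) y hy
    have hbot : P.dualValue ≠ ⊥ := fun h0 => by
      have := hle y₀ (hK ⟨hN.1, ht⟩)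
      rw [h0] at this
      exact EReal.coe_ne_bot _ (le_bot_iff.mp this)
    lift P.dualValue to ℝ using ⟨htop, hbot⟩ with θ
    obtain ⟨n, q, hn, hq, hA, hc⟩ := exists_primal_of_slater P.A P.b P.c N t y₀ hN ht θ
      (fun y h1 h2 => EReal.coe_le_coe_iff.mp (hle y (hK ⟨h1, h2⟩)))
    refine ⟨n + q, ⟨hA, ?_⟩, EReal.coe_le_coe_iff.mpr hc⟩
    rw [mem_dualCone] at hn hq ⊢
    intro x hx
    rw [inner_add_right]
    exact add_nonneg (hn x hx.1) (hq x hx.2)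
  have heq : P.primalValue ((N ⊓ polyCone t : PointedCone ℝ V) : Set V) = P.dualValue := by
    refine le_antisymm ?_ hweak
    by_cases htop : P.dualValue = ⊤
    · rw [htop]
      exact le_top
    · obtain ⟨x, hx, hle⟩ := key htop
      exact (iInf₂_le x hx).trans hle
  refine ⟨heq, fun _ htop => ?_⟩
  obtain ⟨x, hx, hle⟩ := key htop
  exact ⟨x, hx, le_antisymm (hle.trans heq.ge) (iInf₂_le x hx)⟩

/-- Together with `exists_slack_of_not_exists_direction` this characterises where a run stops at a
nonempty face: exactly when a slack lies in its relative interior. -/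
theorem not_exists_direction_of_slack {C : PointedCone ℝ V} {y : F}
    (hy : P.c - LinearMap.adjoint P.A y ∈ coneRi C) :
    ¬ ∃ d ∈ dualCone (C : Set V), P.A d = 0 ∧
      ((⟪P.c, d⟫_ℝ = 0 ∧ ∃ x ∈ (C : Set V), ⟪x, d⟫_ℝ ≠ 0) ∨ ⟪P.c, d⟫_ℝ < 0) := by
  rintro ⟨d, hd, hA, h⟩
  have h1 := slack_inner P.A P.c d y
  rw [hA, inner_zero_left, sub_zero] at h1
  rcases h with ⟨hc, x, hx, hxd⟩ | hc
  · exact hxd (inner_eq_zero_of_mem_coneRi hy hd (h1.trans hc).le hx)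
  · linarith [mem_dualCone.mp hd _ hy.1]

theorem exists_slack_of_not_exists_direction {C : PointedCone ℝ V}
    (h : ¬ ∃ d ∈ dualCone (C : Set V), P.A d = 0 ∧
      ((⟪P.c, d⟫_ℝ = 0 ∧ ∃ x ∈ (C : Set V), ⟪x, d⟫_ℝ ≠ 0) ∨ ⟪P.c, d⟫_ℝ < 0)) :
    ∃ y, P.c - LinearMap.adjoint P.A y ∈ coneRi C := by
  by_contra hcon
  -- With no inequalities the polyhedral part is the whole space, so its dual vector q is zero.
  obtain ⟨n, q, hn, hq, hA, hc⟩ := alternative P.A P.c C ∅ (fun ⟨y, hy, _⟩ => hcon ⟨y, hy⟩)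
  rw [polyCone_empty] at hq
  rw [eq_zero_of_mem_dualCone_top hq, add_zero] at hA hc
  exact h ⟨n, hn, hA, hc.symm⟩

/-- Under the partially polyhedral Slater condition, facial reduction can be completed with at most
one more direction. -/
theorem PartialSlater.exists_isOutput {C : PointedCone ℝ V} (h : P.PartialSlater C) {ds : List V}
    (hC : P.FacialReduction ds (C : Set V)) :
    ∃ ds' : List V, P.IsOutput ds' ∧ ds'.length ≤ ds.length + 1 := by
  obtain ⟨N, t, y₀, rfl, hN, ht⟩ := h
  obtain ⟨d, hd, hA, hc, y, hyN, hyt, hy⟩ := exists_strictly_complementary P.A P.c N t y₀ hN ht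
  have hyd : ⟪P.c - LinearMap.adjoint P.A y, d⟫_ℝ = 0 := by
    rw [slack_inner, hA, hc, inner_zero_left, sub_zero]
  have hri : P.c - LinearMap.adjoint P.A y ∈ coneRi (exposedFace (N ⊓ polyCone t) d) := by
    refine ⟨⟨⟨hyN, hyt⟩, hyd⟩, fun x hx => ?_⟩
    obtain ⟨ε, hε, h1, h2⟩ := hy x hx.1.1 hx.1.2 hx.2
    refine ⟨ε, hε, ⟨h1, h2⟩, ?_⟩
    rw [inner_sub_left, inner_smul_left, hyd, hx.2, mul_zero, sub_zero]
  by_cases hperp : ∃ x ∈ ((N ⊓ polyCone t : PointedCone ℝ V) : Set V), ⟪x, d⟫_ℝ ≠ 0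
  · exact ⟨ds ++ [d], ⟨_, hC.reduce _ _ d hd hA hc hperp,
      Or.inr (not_exists_direction_of_slack hri)⟩, by simp⟩
  · push Not at hperp
    have heq : exposedFace (N ⊓ polyCone t) d = N ⊓ polyCone t := by
      ext x
      exact ⟨fun hx => hx.1, fun hx => ⟨hx, hperp x hx⟩⟩
    rw [heq] at hri
    exact ⟨ds, ⟨_, hC, Or.inr (not_exists_direction_of_slack hri)⟩, by simp⟩

end Program

/-! ### Partially polyhedral facial reduction on products. -/

section Product

variable {E F : Type*} [NormedAddCommGroup E] [InnerProductSpace ℝ E]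
  [NormedAddCommGroup F] [InnerProductSpace ℝ F]

/-- The product of two convex cones. -/
def prodPointedCone (C D : PointedCone ℝ E) : PointedCone ℝ (WithLp 2 (E × E)) :=
  C.comap (WithLp.fstₗ 2 ℝ E E) ⊓ D.comap (WithLp.sndₗ 2 ℝ E E)

theorem mem_prodPointedCone {C D : PointedCone ℝ E} {z : WithLp 2 (E × E)} :
    z ∈ prodPointedCone C D ↔ z.fst ∈ C ∧ z.snd ∈ D := Iff.rfl

theorem prod_inner (z w : WithLp 2 (E × E)) :
    ⟪z, w⟫_ℝ = ⟪z.fst, w.fst⟫_ℝ + ⟪z.snd, w.snd⟫_ℝ := WithLp.prod_inner_apply z w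

theorem mem_dualCone_prodPointedCone {C D : PointedCone ℝ E} {d : WithLp 2 (E × E)} :
    d ∈ dualCone (prodPointedCone C D : Set (WithLp 2 (E × E))) ↔
      d.fst ∈ dualCone (C : Set E) ∧ d.snd ∈ dualCone (D : Set E) := by
  simp only [mem_dualCone]
  constructor
  · intro h
    refine ⟨fun x hx => ?_, fun x hx => ?_⟩
    · simpa [prod_inner] using
        h (WithLp.toLp 2 (x, 0)) (mem_prodPointedCone.mpr ⟨hx, D.zero_mem⟩)
    · simpa [prod_inner] using
        h (WithLp.toLp 2 (0, x)) (mem_prodPointedCone.mpr ⟨C.zero_mem, hx⟩)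
  · rintro ⟨h1, h2⟩ z hz
    rw [prod_inner]
    exact add_nonneg (h1 _ hz.1) (h2 _ hz.2)

/-- Both summands of ⟪z, d⟫ are nonnegative on the product, so their sum vanishes only if each does.
Hence reduction keeps the face a product. -/
theorem exposedFace_prodPointedCone {C D : PointedCone ℝ E} {d : WithLp 2 (E × E)}
    (hd : d ∈ dualCone (prodPointedCone C D : Set (WithLp 2 (E × E)))) :
    exposedFace (prodPointedCone C D) d =
      prodPointedCone (exposedFace C d.fst) (exposedFace D d.snd) := by
  obtain ⟨h1, h2⟩ := mem_dualCone_prodPointedCone.mp hd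
  rw [mem_dualCone] at h1 h2
  ext z
  rw [mem_exposedFace, mem_prodPointedCone, mem_prodPointedCone, mem_exposedFace, mem_exposedFace,
    prod_inner]
  constructor
  · rintro ⟨⟨hC, hD⟩, h0⟩
    have h3 := h1 _ hC
    have h4 := h2 _ hD
    exact ⟨⟨hC, by linarith⟩, hD, by linarith⟩
  · rintro ⟨⟨hC, h3⟩, hD, h4⟩
    exact ⟨⟨hC, hD⟩, by rw [h3, h4, add_zero]⟩

/-- A polyhedral cone goes entirely into the inequalities, leaving N = ⊤ with zero dual; a
nonpolyhedral one stays entirely in N. A vector of the dual of N that is nonzero on N therefore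
occurs only for nonpolyhedral cones. -/
theorem exists_splitting (C : PointedCone ℝ E) :
    ∃ (N : PointedCone ℝ E) (t : Finset E), C = N ⊓ polyCone t ∧
      ((IsPolyhedralCone (C : Set E) ∧ N = ⊤) ∨
        (¬ IsPolyhedralCone (C : Set E) ∧ N = C ∧ t = ∅)) := by
  by_cases h : IsPolyhedralCone (C : Set E)
  · obtain ⟨t, ht⟩ := h
    refine ⟨⊤, t, ?_, Or.inl ⟨⟨t, ht⟩, rfl⟩⟩
    rw [top_inf_eq]
    exact SetLike.coe_injective ht
  · refine ⟨C, ∅, ?_, Or.inr ⟨h, rfl, rfl⟩⟩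
    ext x
    simp [mem_polyCone]

/-- If a splitting of `C` as in `exists_splitting` admits a vector of the dual of `N` which does
not vanish on `N`, then `C` is not polyhedral, and adding vectors in the dual of the polyhedral
part changes nothing. -/
theorem not_polyhedral_of_splitting {C N : PointedCone ℝ E} {t : Finset E}
    (h : (IsPolyhedralCone (C : Set E) ∧ N = ⊤) ∨
      (¬ IsPolyhedralCone (C : Set E) ∧ N = C ∧ t = ∅))
    {n q x : E} (hn : n ∈ dualCone (N : Set E)) (hq : q ∈ dualCone (polyCone t : Set E))
    (hx : x ∈ N) (hxn : ⟪x, n⟫_ℝ ≠ 0) :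
    ¬ IsPolyhedralCone (C : Set E) ∧ ∃ x ∈ C, ⟪x, n + q⟫_ℝ ≠ 0 := by
  rcases h with ⟨-, rfl⟩ | ⟨hC, rfl, rfl⟩
  · rw [eq_zero_of_mem_dualCone_top hn, inner_zero_right] at hxn
    exact absurd rfl hxn
  · rw [polyCone_empty] at hq
    rw [eq_zero_of_mem_dualCone_top hq, add_zero]
    exact ⟨hC, x, hx, hxn⟩

variable [FiniteDimensional ℝ E] [FiniteDimensional ℝ F]

/-- If the partially polyhedral Slater condition fails for a product of cones, then there is a
direction that detects infeasibility or cuts off a part of a nonpolyhedral factor. -/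
theorem partialSlater_or_exists_direction (P : Program (WithLp 2 (E × E)) F)
    (C D : PointedCone ℝ E) :
    P.PartialSlater (prodPointedCone C D) ∨
      ∃ d ∈ dualCone (prodPointedCone C D : Set (WithLp 2 (E × E))), P.A d = 0 ∧
        (⟪P.c, d⟫_ℝ < 0 ∨ (⟪P.c, d⟫_ℝ = 0 ∧
          ((¬ IsPolyhedralCone (C : Set E) ∧ ∃ x ∈ C, ⟪x, d.fst⟫_ℝ ≠ 0) ∨
            (¬ IsPolyhedralCone (D : Set E) ∧ ∃ x ∈ D, ⟪x, d.snd⟫_ℝ ≠ 0)))) := by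
  classical
  obtain ⟨N₁, t₁, hC, h₁⟩ := exists_splitting C
  obtain ⟨N₂, t₂, hD, h₂⟩ := exists_splitting D
  let t : Finset (WithLp 2 (E × E)) :=
    t₁.image (fun a => WithLp.toLp 2 (a, 0)) ∪ t₂.image (fun a => WithLp.toLp 2 (0, a))
  have ht : polyCone t = prodPointedCone (polyCone t₁) (polyCone t₂) := by
    ext z
    simp [t, mem_polyCone, mem_prodPointedCone, or_imp, forall_and]
  have hCD : prodPointedCone C D = prodPointedCone N₁ N₂ ⊓ polyCone t := by
    ext z
    rw [ht, Submodule.mem_inf]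
    simp only [mem_prodPointedCone]
    rw [hC, hD, Submodule.mem_inf, Submodule.mem_inf]
    tauto
  by_cases hS : ∃ y, P.c - LinearMap.adjoint P.A y ∈ coneRi (prodPointedCone N₁ N₂) ∧
      P.c - LinearMap.adjoint P.A y ∈ polyCone t
  · obtain ⟨y, h1, h2⟩ := hS
    exact Or.inl ⟨_, t, y, hCD, h1, h2⟩
  · right
    obtain ⟨n, q, hn, hq, hA, hc⟩ := alternative P.A P.c (prodPointedCone N₁ N₂) t hS
    refine ⟨n + q, ?_, hA, hc.imp_right fun ⟨h0, x, hx, hxn⟩ => ⟨h0, ?_⟩⟩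
    · rw [hCD, mem_dualCone]
      rw [mem_dualCone] at hn hq
      intro x hx
      rw [inner_add_right]
      exact add_nonneg (hn x hx.1) (hq x hx.2)
    · obtain ⟨hn1, hn2⟩ := mem_dualCone_prodPointedCone.mp hn
      rw [ht] at hq
      obtain ⟨hq1, hq2⟩ := mem_dualCone_prodPointedCone.mp hq
      by_cases hx1 : ⟪x.fst, n.fst⟫_ℝ = 0
      · refine Or.inr (not_polyhedral_of_splitting h₂ hn2 hq2 hx.2 fun hx2 => hxn ?_)
        rw [prod_inner, hx1, zero_add]
        exact hx2
      · exact Or.inl (not_polyhedral_of_splitting h₁ hn1 hq1 hx.1 hx1)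

theorem distPoly_exposedFace_add_one_le {C : PointedCone ℝ E} {d : E}
    (hd : d ∈ dualCone (C : Set E)) (hC : ¬ IsPolyhedralCone (C : Set E))
    (h : ∃ x ∈ C, ⟪x, d⟫_ℝ ≠ 0) :
    distPoly (exposedFace C d : Set E) + 1 ≤ distPoly (C : Set E) := by
  obtain ⟨x, hx, hxd⟩ := h
  refine distPoly_add_one_le (isFace_exposedFace hd) (fun heq => hxd ?_) hC
  have : x ∈ (exposedFace C d : Set E) := heq ▸ hx
  exact this.2

/-- The first phase of partially polyhedral facial reduction: the number of steps is controlled by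
the distances to polyhedrality of the factors. -/
theorem exists_facialReduction_partialSlater (P : Program (WithLp 2 (E × E)) F) (m : ℕ) :
    ∀ (ds : List (WithLp 2 (E × E))) (C D : PointedCone ℝ E),
      P.FacialReduction ds (prodPointedCone C D : Set (WithLp 2 (E × E))) →
      distPoly (C : Set E) + distPoly (D : Set E) ≤ m →
      ∃ (ds' : List (WithLp 2 (E × E))) (C' D' : PointedCone ℝ E), C' ≤ C ∧ D' ≤ D ∧
        P.FacialReduction ds' (prodPointedCone C' D' : Set (WithLp 2 (E × E))) ∧
        (ds'.length : ℕ∞) + (distPoly (C' : Set E) + distPoly (D' : Set E)) ≤ ds.length + m ∧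
        (P.PartialSlater (prodPointedCone C' D') ∨
          ∃ d ∈ dualCone (prodPointedCone C' D' : Set (WithLp 2 (E × E))), P.A d = 0 ∧
            ⟪P.c, d⟫_ℝ < 0) := by
  induction m with
  | zero =>
    intro ds C D hFR hm
    refine ⟨ds, C, D, le_rfl, le_rfl, hFR, by gcongr,
      (partialSlater_or_exists_direction P C D).imp_right ?_⟩
    rintro ⟨d, hd, hA, hc | ⟨-, h⟩⟩
    · exact ⟨d, hd, hA, hc⟩
    · exfalso
      -- With no distance left both factors are polyhedral, so no direction can cut a nonpolyhedral
      -- one.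
      rw [Nat.cast_zero, nonpos_iff_eq_zero, add_eq_zero] at hm
      rcases h with ⟨h, -⟩ | ⟨h, -⟩
      · simpa [hm.1] using one_le_distPoly h
      · simpa [hm.2] using one_le_distPoly h
  | succ m ih =>
    intro ds C D hFR hm
    rcases partialSlater_or_exists_direction P C D with h | ⟨d, hd, hA, hc | ⟨hc, h⟩⟩
    · exact ⟨ds, C, D, le_rfl, le_rfl, hFR, by gcongr, Or.inl h⟩
    · exact ⟨ds, C, D, le_rfl, le_rfl, hFR, by gcongr, Or.inr ⟨d, hd, hA, hc⟩⟩
    · obtain ⟨hd1, hd2⟩ := mem_dualCone_prodPointedCone.mp hd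
      have hperp : ∃ x ∈ (prodPointedCone C D : Set (WithLp 2 (E × E))), ⟪x, d⟫_ℝ ≠ 0 := by
        rcases h with ⟨-, x, hx, hxd⟩ | ⟨-, x, hx, hxd⟩
        · exact ⟨WithLp.toLp 2 (x, 0), ⟨hx, D.zero_mem⟩, by simpa [prod_inner] using hxd⟩
        · exact ⟨WithLp.toLp 2 (0, x), ⟨C.zero_mem, hx⟩, by simpa [prod_inner] using hxd⟩
      have hstep := hFR.reduce _ _ d hd hA hc hperp
      change P.FacialReduction _ (exposedFace (prodPointedCone C D) d : Set _) at hstep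
      rw [exposedFace_prodPointedCone hd] at hstep
      have hdrop : distPoly (exposedFace C d.fst : Set E) + distPoly (exposedFace D d.snd : Set E)
          + 1 ≤ distPoly (C : Set E) + distPoly (D : Set E) := by
        rcases h with ⟨hp, hx⟩ | ⟨hp, hx⟩
        · rw [add_right_comm]
          exact add_le_add (distPoly_exposedFace_add_one_le hd1 hp hx)
            (isFace_exposedFace hd2).distPoly_le
        · rw [add_assoc]
          exact add_le_add (isFace_exposedFace hd1).distPoly_le
            (distPoly_exposedFace_add_one_le hd2 hp hx)
      obtain ⟨ds', C', D', hC', hD', hFR', hlen, hend⟩ := ih _ _ _ hstep (by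
        have := hdrop.trans hm
        rw [Nat.cast_add, Nat.cast_one] at this
        exact (ENat.add_le_add_iff_right ENat.one_ne_top).mp this)
      refine ⟨ds', C', D', hC'.trans fun x hx => hx.1, hD'.trans fun x hx => hx.1, hFR',
        hlen.trans_eq ?_, hend⟩
      simp only [List.length_append, List.length_singleton, Nat.cast_add, Nat.cast_one]
      rw [add_assoc, add_comm 1]

end Product

/-! ### Comparison of the duplicated problem with the problem over the intersection. -/

section Duplication

variable {E F : Type*} [NormedAddCommGroup E] [InnerProductSpace ℝ E]
  [NormedAddCommGroup F] [InnerProductSpace ℝ F]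
  {K₁ K₂ : ProperCone ℝ E} {A : E →ₗ[ℝ] F} {b : F} {c : E}

/-- The trace of a subset of the product space on the diagonal. -/
def diag (G : Set (WithLp 2 (E × E))) : Set E := {x | WithLp.toLp 2 (x, x) ∈ G}

theorem inner_toLp_self (x : E) (d : WithLp 2 (E × E)) :
    ⟪WithLp.toLp 2 (x, x), d⟫_ℝ = ⟪x, d.fst + d.snd⟫_ℝ := by
  rw [prod_inner, inner_add_right]
  rfl

theorem dupProgram_inner_c (d : WithLp 2 (E × E)) :
    ⟪(dupProgram K₁ K₂ A b c).c, d⟫_ℝ = ⟪c, d.fst + d.snd⟫_ℝ :=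
  inner_toLp_self c d

theorem dupProgram_A_apply (d : WithLp 2 (E × E)) :
    (dupProgram K₁ K₂ A b c).A d = A (d.fst + d.snd) := rfl

theorem add_mem_dualCone_diag {G : Set (WithLp 2 (E × E))} {d : WithLp 2 (E × E)}
    (hd : d ∈ dualCone G) : d.fst + d.snd ∈ dualCone (diag G) := by
  rw [mem_dualCone] at hd ⊢
  intro x hx
  rw [← inner_toLp_self]
  exact hd _ hx

/-- Facial reduction for the duplicated problem induces facial reduction for the problem over the
intersection, with at most as many directions. -/
theorem exists_facialReduction_diag {ds : List (WithLp 2 (E × E))} {G : Set (WithLp 2 (E × E))}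
    (h : (dupProgram K₁ K₂ A b c).FacialReduction ds G) :
    ∃ ds' : List E, ds'.length ≤ ds.length ∧
      (interProgram K₁ K₂ A b c).FacialReduction ds' (diag G) := by
  induction h with
  | start => exact ⟨[], le_rfl, .start⟩
  | reduce ds G d hG hd hA hc hperp ih =>
    obtain ⟨ds', hlen, hFR⟩ := ih
    have heq : diag (G ∩ {x | ⟪x, d⟫_ℝ = 0}) =
        diag G ∩ {x | ⟪x, d.fst + d.snd⟫_ℝ = 0} := by
      ext x
      simp only [diag, Set.mem_inter_iff, Set.mem_ofPred_eq, inner_toLp_self]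
    rw [heq]
    rw [dupProgram_inner_c] at hc
    by_cases hx : ∃ x ∈ diag G, ⟪x, d.fst + d.snd⟫_ℝ ≠ 0
    · exact ⟨ds' ++ [d.fst + d.snd], by simpa using hlen,
        hFR.reduce _ _ _ (add_mem_dualCone_diag hd) hA hc hx⟩
    · push Not at hx
      rw [Set.inter_eq_left.mpr (show diag G ⊆ {x | ⟪x, d.fst + d.snd⟫_ℝ = 0} from hx)]
      exact ⟨ds', hlen.trans (by simp), hFR⟩
  | infeasible ds G d hG hne hd hA hc ih =>
    obtain ⟨ds', hlen, hFR⟩ := ih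
    rw [dupProgram_inner_c] at hc
    refine ⟨ds' ++ [d.fst + d.snd], by simpa using hlen,
      hFR.infeasible _ _ _ ?_ (add_mem_dualCone_diag hd) hA hc⟩
    rcases hG.eq_empty_or_pointedCone with rfl | ⟨C, rfl⟩
    · exact absurd hne Set.not_nonempty_empty
    · exact ⟨0, C.zero_mem⟩

variable [FiniteDimensional ℝ E] [FiniteDimensional ℝ F]

theorem dupProgram_dualFeasible :
    (dupProgram K₁ K₂ A b c).dualFeasible = (interProgram K₁ K₂ A b c).dualFeasible := by
  ext y
  simp only [Program.dualFeasible, Set.mem_ofPred_eq, dupProgram_slack]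
  rfl

theorem dupProgram_dualValue :
    (dupProgram K₁ K₂ A b c).dualValue = (interProgram K₁ K₂ A b c).dualValue := by
  unfold Program.dualValue
  rw [dupProgram_dualFeasible]
  rfl

theorem mem_dupProgram_feasibleSlacks {z : WithLp 2 (E × E)} :
    z ∈ (dupProgram K₁ K₂ A b c).feasibleSlacks ↔
      ∃ s ∈ (interProgram K₁ K₂ A b c).feasibleSlacks, z = WithLp.toLp 2 (s, s) := by
  constructor
  · rintro ⟨hz, y, rfl⟩
    rw [dupProgram_slack] at hz ⊢
    exact ⟨_, ⟨hz, y, rfl⟩, rfl⟩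
  · rintro ⟨_, ⟨hs, y, rfl⟩, rfl⟩
    exact ⟨hs, y, (dupProgram_slack K₁ K₂ A b c y).symm⟩

theorem mem_dupProgram_dualMinFace {z : WithLp 2 (E × E)} :
    z ∈ (dupProgram K₁ K₂ A b c).dualMinFace ↔ (z.fst ∈ K₁ ∧ z.snd ∈ K₂) ∧
      ∃ s ∈ (interProgram K₁ K₂ A b c).feasibleSlacks, ∃ ε > (0 : ℝ),
        s - ε • z.fst ∈ K₁ ∧ s - ε • z.snd ∈ K₂ := by
  rw [Program.dualMinFace_eq]
  constructor
  · rintro ⟨hz, w, hw, ε, hε, h⟩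
    obtain ⟨s, hs, rfl⟩ := mem_dupProgram_feasibleSlacks.mp hw
    exact ⟨hz, s, hs, ε, hε, h⟩
  · rintro ⟨hz, s, hs, ε, hε, h⟩
    exact ⟨hz, _, mem_dupProgram_feasibleSlacks.mpr ⟨s, hs, rfl⟩, ε, hε, h⟩

/-- The minimal face of the duplicated problem is a product of faces. -/
theorem exists_dualMinFace_dupProgram_eq (K₁ K₂ : ProperCone ℝ E) (A : E →ₗ[ℝ] F) (b : F) (c : E) :
    ∃ F₁ F₂ : Set E, IsFace (K₁ : Set E) F₁ ∧ IsFace (K₂ : Set E) F₂ ∧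
      (dupProgram K₁ K₂ A b c).dualMinFace = prodSet F₁ F₂ := by
  have hS := (interProgram K₁ K₂ A b c).convex_feasibleSlacks
  refine ⟨_, _, isFace_radialFace (K := (K₁ : PointedCone ℝ E)) hS fun s hs => hs.1.1,
    isFace_radialFace (K := (K₂ : PointedCone ℝ E)) hS fun s hs => hs.1.2, ?_⟩
  ext z
  rw [mem_dupProgram_dualMinFace]
  constructor
  · rintro ⟨⟨h1, h2⟩, s, hs, ε, hε, h3, h4⟩
    exact ⟨⟨h1, s, hs, ε, hε, h3⟩, ⟨h2, s, hs, ε, hε, h4⟩⟩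
  · rintro ⟨⟨h1, s, hs, ε, hε, h3⟩, ⟨h2, s', hs', ε', hε', h4⟩⟩
    -- The midpoint of the two slacks serves both factors; halving the slacks halves the admissible
    -- step.
    refine ⟨⟨h1, h2⟩, _, hS hs hs' (a := 1 / 2) (b := 1 / 2) (by norm_num) (by norm_num)
      (by norm_num), 1 / 2 * min ε ε', by positivity, ?_, ?_⟩
    · have h5 := sub_smul_mem_of_le (N := (K₁ : PointedCone ℝ E)) hs.1.1 h3 (lt_min hε hε')
        (min_le_left _ _)
      have h6 := (K₁ : PointedCone ℝ E).smul_mem (r := (1 / 2 : ℝ)) (by norm_num)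
        (add_mem h5 hs'.1.1)
      rw [ProperCone.mem_toPointedCone] at h6
      convert h6 using 1
      module
    · have h5 := sub_smul_mem_of_le (N := (K₂ : PointedCone ℝ E)) hs'.1.2 h4 (lt_min hε hε')
        (min_le_right _ _)
      have h6 := (K₂ : PointedCone ℝ E).smul_mem (r := (1 / 2 : ℝ)) (by norm_num)
        (add_mem h5 hs.1.2)
      rw [ProperCone.mem_toPointedCone] at h6
      convert h6 using 1
      module

theorem mem_interProgram_dualMinFace {x : E} :
    x ∈ (interProgram K₁ K₂ A b c).dualMinFace ↔
      WithLp.toLp 2 (x, x) ∈ (dupProgram K₁ K₂ A b c).dualMinFace := by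
  rw [mem_dupProgram_dualMinFace, Program.dualMinFace_eq]
  rfl

/-- A complete run ends at the empty face or at a cone with a slack (s, s) in its relative interior.
In the latter case s is in the relative interior of the diagonal trace, so the induced run is
complete too. -/
theorem singularityDegree_interProgram_le :
    (interProgram K₁ K₂ A b c).singularityDegree ≤ (dupProgram K₁ K₂ A b c).singularityDegree := by
  refine le_sInf ?_
  rintro _ ⟨ds, ⟨G, hFR, hend⟩, rfl⟩
  obtain ⟨ds', hlen, hFR'⟩ := exists_facialReduction_diag hFR
  refine (Program.IsOutput.singularityDegree_le ⟨diag G, hFR', ?_⟩).trans (Nat.cast_le.mpr hlen)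
  rcases hFR.eq_empty_or_pointedCone with rfl | ⟨C, rfl⟩
  · exact Or.inl rfl
  · rcases hend with h | h
    · exact absurd h (Set.Nonempty.ne_empty ⟨0, C.zero_mem⟩)
    · right
      obtain ⟨y, hy⟩ := Program.exists_slack_of_not_exists_direction h
      rw [dupProgram_slack] at hy
      let D : PointedCone ℝ E :=
        C.comap ((WithLp.linearEquiv 2 ℝ (E × E)).symm.toLinearMap ∘ₗ
          LinearMap.prod LinearMap.id LinearMap.id)
      refine Program.not_exists_direction_of_slack (P := interProgram K₁ K₂ A b c) (C := D) (y := y)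
        ⟨hy.1, fun x hx => ?_⟩
      exact hy.2 _ hx

/-- Adding the two components carries primal points to primal points with the same objective, and
weak duality gives the reverse inequality of values. -/
theorem distStrongDuality_interProgram_le :
    (interProgram K₁ K₂ A b c).distStrongDuality ≤ (dupProgram K₁ K₂ A b c).distStrongDuality := by
  refine le_sInf ?_
  rintro _ ⟨ds, G, hFR, ⟨hval, hatt⟩, rfl⟩
  obtain ⟨ds', hlen, hFR'⟩ := exists_facialReduction_diag hFR
  refine (Program.StrongDualityAt.distStrongDuality_le ?_ hFR').trans (Nat.cast_le.mpr hlen)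
  have hfeas : ∀ z ∈ (dupProgram K₁ K₂ A b c).primalFeasible G,
      z.fst + z.snd ∈ (interProgram K₁ K₂ A b c).primalFeasible (diag G) := fun z hz =>
    ⟨hz.1, add_mem_dualCone_diag hz.2⟩
  have hle : (interProgram K₁ K₂ A b c).primalValue (diag G) ≤
      (dupProgram K₁ K₂ A b c).primalValue G := le_iInf₂ fun z hz => by
    rw [dupProgram_inner_c]
    exact iInf₂_le _ (hfeas z hz)
  rw [dupProgram_dualValue] at hval hatt
  have heq : (interProgram K₁ K₂ A b c).primalValue (diag G) =
      (interProgram K₁ K₂ A b c).dualValue :=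
    le_antisymm (hle.trans hval.le)
      (Program.dualValue_le_primalValue hFR'.feasibleSlacks_subset)
  refine ⟨heq, fun h1 h2 => ?_⟩
  obtain ⟨z, hz, hzv⟩ := hatt h1 h2
  refine ⟨_, hfeas z hz, ?_⟩
  rw [heq, ← hval, ← hzv, dupProgram_inner_c]
  rfl

/-- The outcome of the first phase of partially polyhedral facial reduction, applied to the
duplicated problem. -/
theorem exists_facialReduction_dupProgram (K₁ K₂ : ProperCone ℝ E) (A : E →ₗ[ℝ] F) (b : F) (c : E) :
    ∃ (ds : List (WithLp 2 (E × E))) (C D : PointedCone ℝ E), (C : Set E) ⊆ K₁ ∧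
      (D : Set E) ⊆ K₂ ∧
      (dupProgram K₁ K₂ A b c).FacialReduction ds
        (prodPointedCone C D : Set (WithLp 2 (E × E))) ∧
      (ds.length : ℕ∞) + (distPoly (C : Set E) + distPoly (D : Set E)) ≤
        distPoly (K₁ : Set E) + distPoly (K₂ : Set E) ∧
      ((dupProgram K₁ K₂ A b c).PartialSlater (prodPointedCone C D) ∨
        ∃ d ∈ dualCone (prodPointedCone C D : Set (WithLp 2 (E × E))),
          (dupProgram K₁ K₂ A b c).A d = 0 ∧ ⟪(dupProgram K₁ K₂ A b c).c, d⟫_ℝ < 0) := by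
  have h₁ := distPoly_lt_top (K₁ : PointedCone ℝ E)
  have h₂ := distPoly_lt_top (K₂ : PointedCone ℝ E)
  obtain ⟨m₁, hm₁⟩ := ENat.ne_top_iff_exists.mp h₁.ne
  obtain ⟨m₂, hm₂⟩ := ENat.ne_top_iff_exists.mp h₂.ne
  obtain ⟨ds, C, D, hC, hD, hFR, hlen, hend⟩ := exists_facialReduction_partialSlater
    (dupProgram K₁ K₂ A b c) (m₁ + m₂) [] (K₁ : PointedCone ℝ E) (K₂ : PointedCone ℝ E) .start
    (by rw [Nat.cast_add, hm₁, hm₂])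
  refine ⟨ds, C, D, hC, hD, hFR, hlen.trans_eq ?_, hend⟩
  rw [Nat.cast_add, hm₁, hm₂, List.length_nil, Nat.cast_zero, zero_add]
  rfl

theorem singularityDegree_dupProgram_le (K₁ K₂ : ProperCone ℝ E) (A : E →ₗ[ℝ] F) (b : F) (c : E) :
    (dupProgram K₁ K₂ A b c).singularityDegree ≤
      1 + distPoly (K₁ : Set E) + distPoly (K₂ : Set E) := by
  obtain ⟨ds, C, D, -, -, hFR, hlen, hend⟩ := exists_facialReduction_dupProgram K₁ K₂ A b c
  have hlen' : ((ds.length + 1 : ℕ) : ℕ∞) ≤ 1 + distPoly (K₁ : Set E) + distPoly (K₂ : Set E) := by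
    rw [Nat.cast_add, Nat.cast_one, add_comm, add_assoc]
    gcongr
    exact le_self_add.trans hlen
  rcases hend with h | ⟨d, hd, hA, hc⟩
  · obtain ⟨ds', hout, hle⟩ := h.exists_isOutput hFR
    exact hout.singularityDegree_le.trans ((Nat.cast_le.mpr hle).trans hlen')
  · refine (Program.IsOutput.singularityDegree_le
      ⟨∅, hFR.infeasible _ _ d ⟨0, zero_mem _⟩ hd hA hc, Or.inl rfl⟩).trans ?_
    simpa using hlen'

theorem distStrongDuality_dupProgram_le (K₁ K₂ : ProperCone ℝ E) (A : E →ₗ[ℝ] F) (b : F) (c : E)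
    (hfeas : (interProgram K₁ K₂ A b c).dualFeasible.Nonempty ∨
      ((interProgram K₁ K₂ A b c).primalFeasible ((K₁ ⊓ K₂ : ProperCone ℝ E) : Set E)).Nonempty) :
    (dupProgram K₁ K₂ A b c).distStrongDuality ≤
      distPoly (K₁ : Set E) + distPoly (K₂ : Set E) := by
  obtain ⟨ds, C, D, hC, hD, hFR, hlen, hend⟩ := exists_facialReduction_dupProgram K₁ K₂ A b c
  rcases hend with h | ⟨d, hd, hA, hc⟩
  · exact ((h.strongDualityAt hFR.feasibleSlacks_subset hFR.subset).distStrongDuality_le hFR).trans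
      (le_self_add.trans hlen)
  have hFR' := hFR.infeasible _ _ d ⟨0, zero_mem _⟩ hd hA hc
  rcases hfeas with ⟨y, hy⟩ | ⟨x, hxA, hx⟩
  · rw [← dupProgram_dualFeasible] at hy
    exact absurd (hFR'.feasibleSlacks_subset ⟨hy, y, rfl⟩) (Set.notMem_empty _)
  -- The dual value is -∞ and d decreases the primal objective without bound from any primal point.
  -- If the budget allows the infeasible step, (x, 0) is such a point, because the dual cone of ∅ is
  -- the whole space.
  by_cases hlt : (ds.length : ℕ∞) + 1 ≤ distPoly (K₁ : Set E) + distPoly (K₂ : Set E)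
  · refine ((Program.strongDualityAt_of_infeasible hFR'.feasibleSlacks_subset (d := d)
      (x := WithLp.toLp 2 (x, 0)) ?_ hA hc ⟨?_, ?_⟩).distStrongDuality_le hFR').trans
      (by simpa using hlt)
    · simp [mem_dualCone]
    · rw [dupProgram_A_apply]
      exact (congrArg A (add_zero x)).trans hxA
    · simp [mem_dualCone]
  -- No room for one more step means that no distance is left in either factor. Then x splits into a
  -- primal point for C × D, where d already works.
  · have hCpoly : IsPolyhedralCone (C : Set E) := by
      by_contra hcon
      refine hlt (le_trans ?_ hlen)
      gcongr
      exact (one_le_distPoly hcon).trans le_self_add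
    have hDpoly : IsPolyhedralCone (D : Set E) := by
      by_contra hcon
      refine hlt (le_trans ?_ hlen)
      gcongr
      exact (one_le_distPoly hcon).trans le_add_self
    have hxCD : x ∈ dualCone ((C : Set E) ∩ D) := by
      rw [mem_dualCone] at hx ⊢
      exact fun z hz => hx z ⟨hC hz.1, hD hz.2⟩
    obtain ⟨u, hu, v, hv, rfl⟩ := hCpoly.exists_add_of_mem_dualCone_inter hDpoly hxCD
    exact ((Program.strongDualityAt_of_infeasible hFR.feasibleSlacks_subset hd hA hc
      (x := WithLp.toLp 2 (u, v)) ⟨hxA, mem_dualCone_prodPointedCone.mpr ⟨hu, hv⟩⟩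
      ).distStrongDuality_le hFR).trans (le_self_add.trans hlen)

end Duplication

end ConicLP

end

theorem mainTheorem7 {E F : Type*}
    [NormedAddCommGroup E] [InnerProductSpace ℝ E] [FiniteDimensional ℝ E]
    [NormedAddCommGroup F] [InnerProductSpace ℝ F] [FiniteDimensional ℝ F]
    (K₁ K₂ : ProperCone ℝ E) (A : E →ₗ[ℝ] F) (b : F) (c : E) :
    -- the minimal face of the duplicated problem is a product `F₁ × F₂` of faces,
    (∃ F₁ F₂ : Set E, ConicLP.IsFace (K₁ : Set E) F₁ ∧ ConicLP.IsFace (K₂ : Set E) F₂ ∧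
      (ConicLP.dupProgram K₁ K₂ A b c).dualMinFace = ConicLP.prodSet F₁ F₂) ∧
    -- and the minimal face of the problem over the intersection is `F₁ ∩ F₂`;
    (∀ F₁ F₂ : Set E,
      (ConicLP.dupProgram K₁ K₂ A b c).dualMinFace = ConicLP.prodSet F₁ F₂ →
      (ConicLP.interProgram K₁ K₂ A b c).dualMinFace = F₁ ∩ F₂) ∧
    -- the distances to polyhedrality are finite;
    ConicLP.distPoly (K₁ : Set E) < ⊤ ∧ ConicLP.distPoly (K₂ : Set E) < ⊤ ∧
    -- bounds on the singularity degree;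
    (ConicLP.interProgram K₁ K₂ A b c).singularityDegree ≤
      (ConicLP.dupProgram K₁ K₂ A b c).singularityDegree ∧
    (ConicLP.dupProgram K₁ K₂ A b c).singularityDegree ≤
      1 + ConicLP.distPoly (K₁ : Set E) + ConicLP.distPoly (K₂ : Set E) ∧
    -- bounds on the distance to strong duality; the last one needs that the problem over the
    -- intersection or its primal is feasible.
    (ConicLP.interProgram K₁ K₂ A b c).distStrongDuality ≤
      (ConicLP.dupProgram K₁ K₂ A b c).distStrongDuality ∧
    (((ConicLP.interProgram K₁ K₂ A b c).dualFeasible.Nonempty ∨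
        ((ConicLP.interProgram K₁ K₂ A b c).primalFeasible ((K₁ ⊓ K₂ : ProperCone ℝ E) : Set E)).Nonempty) →
      (ConicLP.dupProgram K₁ K₂ A b c).distStrongDuality ≤
        ConicLP.distPoly (K₁ : Set E) + ConicLP.distPoly (K₂ : Set E)) :=
  ⟨ConicLP.exists_dualMinFace_dupProgram_eq K₁ K₂ A b c,
    fun F₁ F₂ h => Set.ext fun x => by
      rw [ConicLP.mem_interProgram_dualMinFace, h]
      rfl,
    ConicLP.distPoly_lt_top (K₁ : PointedCone ℝ E), ConicLP.distPoly_lt_top (K₂ : PointedCone ℝ E),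
    ConicLP.singularityDegree_interProgram_le, ConicLP.singularityDegree_dupProgram_le K₁ K₂ A b c,
    ConicLP.distStrongDuality_interProgram_le,
    ConicLP.distStrongDuality_dupProgram_le K₁ K₂ A b c⟩
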